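/- **Data.** Let $n\ge 3$, let $(\bar M,\bar h)$ be a smooth $n$-dimensional Riemannian manifold, $\mathscr K$ a smooth $(1,1)$-tensor field on $\bar M$ and $\Phi_a,\Phi_b\in C^\infty(\bar M)$. Suppose that $(\bar M,\bar h,\mathscr K,\Phi_a,\Phi_b)$ are *non-degenerate quiescent initial data on the singularity for the Einstein–scalar field equations* with cosmological constant $\Lambda=0$ (in units in which Einstein's equations read $\mathrm{Ric}-\frac12 S g=T$), i.e. 1. $\mathrm{tr}\,\mathscr K=1$ and $\mathscr K$ is symmetric with respect to $\bar h$; 2. $\mathrm{tr}\,\mathscr K^2+\Phi_a^2=1$ and $\mathrm{div}_{\bar h}\mathscr K=\Phi_a\,d\Phi_b$; 3. at every point $\mathscr K$ has $n$ distinct eigenvalues $p_1<\dots<p_n$; 4. if $1+p_A(\bar x)-p_B(\bar x)-p_C(\bar x)\le 0$, then $(\gamma^A_{BC})^2$ vanishes in a neighbourhood of $\bar x$, where $[\mathscr X_B,\mathscr X_C]=\sum_A\gamma^A_{BC}\mathscr X_A$ for a local smooth frame of eigenvector fields $\mathscr X_A$ of $\mathscr K$ with $\mathscr K\mathscr X_A=p_A\mathscr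 X_A$ and $|\mathscr X_A|_{\bar h}=1$ (such a frame is unique up to signs). Let $\{\mathscr Y^A\}$ be the basis dual to $\{\mathscr X_A\}$ ($\mathscr Y^A$ is determined up to sign, so $\mathscr Y^A\otimes\mathscr Y^A$ is globally well defined) and, for $t>0$, set $${}^0g=\sum_A t^{2p_A}\,\mathscr Y^A\otimes\mathscr Y^A,\qquad {}^0k=-\sum_A p_A t^{2p_A-1}\,\mathscr Y^A\otimes\mathscr Y^A,\qquad {}^0\phi=\Phi_a\ln t+\Phi_b .$$ **Conclusion.** $({}^0g,{}^0k,{}^0\phi)$ is a smooth velocity dominated solution on $(0,\infty)\times\bar M$. That is, ${}^0g,{}^0k,{}^0\phi$ are smooth in $(t,x)\in(0,\infty)\times\bar M$; for every $t>0$, ${}^0g$ is a Riemannian metric on $\bar M$ and ${}^0k$ is symmetric; and, with indices raised by ${}^0g$, with $\nabla$ the Levi-Civita connection of ${}^0g$ (at fixed $t$), and with $${}^0\rho=\tfrac12(\partial_t{}^0\phi)^2,\qquad {}^0j_b=-\partial_t{}^0\phi\;\partial_b{}^0\phi,\qquad {}^0S_{ab}=\tfrac12(\partial_t{}^0\phi)^2\,{}^0g_{ab},$$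 the following velocity dominated Einstein–scalar field equations hold: $$-{}^0k_{ij}{}^0k^{ij}+(\mathrm{tr}\,{}^0k)^2=2\,{}^0\rho,\qquad \nabla^a\,{}^0k_{ab}-\partial_b(\mathrm{tr}\,{}^0k)={}^0j_b,$$ $$\partial_t{}^0g_{ab}=-2\,{}^0k_{ab},$$ $$\partial_t{}^0k^a{}_b=(\mathrm{tr}\,{}^0k)\,{}^0k^a{}_b-\Big({}^0S^a{}_b-\tfrac1{n-1}(\mathrm{tr}\,{}^0S)\,\delta^a_b\Big)-\tfrac1{n-1}\,{}^0\rho\,\delta^a_b,$$ $$\partial_t^2\,{}^0\phi-(\mathrm{tr}\,{}^0k)\,\partial_t{}^0\phi=0 .$$ -/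

import Mathlib

open Set Filter Topology Bundle
open scoped Manifold ContDiff

noncomputable section

/-- Vector fields (no regularity imposed) on an `n`-dimensional manifold `M`. -/
abbrev VField (n : ℕ) (M : Type*) [TopologicalSpace M] [ChartedSpace (EuclideanSpace ℝ (Fin n)) M] :
    Type _ :=
  ∀ x : M, TangentSpace (𝓡 n) x

/-- One-form fields (no regularity imposed). -/
abbrev CovField (n : ℕ) (M : Type*) [TopologicalSpace M]
    [ChartedSpace (EuclideanSpace ℝ (Fin n)) M] : Type _ :=
  ∀ x : M, TangentSpace (𝓡 n) x →L[ℝ] ℝ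

/-- `(1,1)`-tensor fields (no regularity imposed). -/
abbrev EndField (n : ℕ) (M : Type*) [TopologicalSpace M]
    [ChartedSpace (EuclideanSpace ℝ (Fin n)) M] : Type _ :=
  ∀ x : M, TangentSpace (𝓡 n) x →L[ℝ] TangentSpace (𝓡 n) x

/-- Covariant `2`-tensor fields (no regularity imposed). -/
abbrev BilinField (n : ℕ) (M : Type*) [TopologicalSpace M]
    [ChartedSpace (EuclideanSpace ℝ (Fin n)) M] : Type _ :=
  ∀ x : M, TangentSpace (𝓡 n) x →L[ℝ] TangentSpace (𝓡 n) x →L[ℝ] ℝ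

/-- Affine connections on `M`. -/
abbrev AffineConn (n : ℕ) (M : Type*) [TopologicalSpace M]
    [ChartedSpace (EuclideanSpace ℝ (Fin n)) M] [IsManifold (𝓡 n) ∞ M] : Type _ :=
  CovariantDerivative (𝓡 n) (EuclideanSpace ℝ (Fin n)) (fun x : M => TangentSpace (𝓡 n) x)

/-- Smooth Riemannian metrics on `M`. -/
abbrev SmoothMetric (n : ℕ) (M : Type*) [TopologicalSpace M]
    [ChartedSpace (EuclideanSpace ℝ (Fin n)) M] [IsManifold (𝓡 n) ∞ M] : Type _ :=
  ContMDiffRiemannianMetric (𝓡 n) ∞ (EuclideanSpace ℝ (Fin n))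
    (fun x : M => TangentSpace (𝓡 n) x)

section Geometry

variable {n : ℕ} {M : Type*} [TopologicalSpace M] [ChartedSpace (EuclideanSpace ℝ (Fin n)) M]

/-- The trace of an endomorphism of a tangent space. -/
def endTrace {x : M} (T : TangentSpace (𝓡 n) x →L[ℝ] TangentSpace (𝓡 n) x) : ℝ :=
  LinearMap.trace ℝ (TangentSpace (𝓡 n) x) T.toLinearMap

/-- Raising the first index of the covariant `2`-tensor `b` with the metric `g`: the endomorphism
with components `b^a_b = g^{ac} b_{cb}`. -/
def raiseIndex {x : M} (g b : TangentSpace (𝓡 n) x →L[ℝ] TangentSpace (𝓡 n) x →L[ℝ] ℝ) :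
    TangentSpace (𝓡 n) x →L[ℝ] TangentSpace (𝓡 n) x :=
  g.inverse ∘L b

variable [IsManifold (𝓡 n) ∞ M]

/-- The vector field `X` is differentiable at `x`. -/
def VFieldDiffAt (X : VField n M) (x : M) : Prop :=
  MDifferentiableAt (𝓡 n) (𝓡 n).tangent
    (fun y => (⟨y, X y⟩ : TangentBundle (𝓡 n) M)) x

/-- The vector field `X` is smooth near `x`. -/
def VFieldSmoothAt (X : VField n M) (x : M) : Prop :=
  ContMDiffAt (𝓡 n) (𝓡 n).tangent ∞
    (fun y => (⟨y, X y⟩ : TangentBundle (𝓡 n) M)) x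

/-- `D` is the Levi-Civita connection of `g`: it is torsion free and compatible with `g`. -/
def IsLeviCivita (g : BilinField n M) (D : AffineConn n M) : Prop :=
  D.torsion = 0 ∧
  ∀ (x : M) (v : TangentSpace (𝓡 n) x) (Y Z : VField n M),
    VFieldDiffAt Y x → VFieldDiffAt Z x →
      mvfderiv (𝓡 n) (fun y => g y (Y y) (Z y)) x v =
        g x (D Y x v) (Z x) + g x (Y x) (D Z x v)

/-- The divergence `(div T)_b = D_a T^a_b` of a `(1,1)`-tensor field `T` with respect to a
connection `D`, evaluated at the vector `w`: the trace of `v ↦ (D_v T) w`, where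
`(D_v T) W = D_v (T W) - T (D_v W)` and `W` is the extension of `w` which is constant in the
preferred trivialization at the point. -/
def divergence (D : AffineConn n M) (T : EndField n M) (x : M) (w : TangentSpace (𝓡 n) x) : ℝ :=
  endTrace
    (D (fun y => T y (FiberBundle.extend (EuclideanSpace ℝ (Fin n)) w y)) x -
      T x ∘L D (FiberBundle.extend (EuclideanSpace ℝ (Fin n)) w) x)

/-- `div_g T = α`, the divergence being taken with the Levi-Civita connection of `g`. -/
def DivEq (g : BilinField n M) (T : EndField n M) (α : CovField n M) : Prop :=
  ∃ D : AffineConn n M, IsLeviCivita g D ∧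
    ∀ (x : M) (w : TangentSpace (𝓡 n) x), divergence D T x w = α x w

end Geometry

section Data

variable {n : ℕ} {M : Type*} [TopologicalSpace M] [ChartedSpace (EuclideanSpace ℝ (Fin n)) M]

/-- The functions `p 0 < ⋯ < p (n - 1)` are, at every point, the (distinct) eigenvalues of `K`. -/
def AreOrderedEigenvalues (K : EndField n M) (p : Fin n → M → ℝ) : Prop :=
  ∀ x : M, StrictMono (fun A => p A x) ∧
    ∀ A, Module.End.HasEigenvalue (K x).toLinearMap (p A x)

/-- At the point `x`, the vectors `X A` are unit eigenvectors of `K` with eigenvalues `p A`. -/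
def IsUnitEigenframeAt (h : BilinField n M) (K : EndField n M) (p : Fin n → M → ℝ)
    (X : Fin n → VField n M) (x : M) : Prop :=
  ∀ A, K x (X A x) = p A x • X A x ∧ h x (X A x) (X A x) = 1

/-- Near the point `x`, the `X A` are smooth unit eigenvector fields of `K` with eigenvalues
`p A`. -/
def IsSmoothUnitEigenframeNear [IsManifold (𝓡 n) ∞ M] (h : BilinField n M) (K : EndField n M) (p : Fin n → M → ℝ)
    (X : Fin n → VField n M) (x : M) : Prop :=
  (∀ A, VFieldSmoothAt (X A) x) ∧ ∀ᶠ y in 𝓝 x, IsUnitEigenframeAt h K p X y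

/-- The numbers `γ A B C` are the structure coefficients of the frame `X` at `x`:
`[X_B, X_C] = ∑_A γ^A_{BC} X_A`. -/
def AreStructureCoeffsAt (X : Fin n → VField n M) (γ : Fin n → Fin n → Fin n → ℝ) (x : M) : Prop :=
  ∀ B C, VectorField.mlieBracket (𝓡 n) (X B) (X C) x = ∑ A, γ A B C • X A x

/-- `𝒪^A_{BC}(x) = (γ^A_{BC})² = 0`, where the `γ^A_{BC}` are the structure coefficients at `x` of
a local smooth frame of unit eigenvector fields (which is unique up to signs, on which
`(γ^A_{BC})²` does not depend). -/
def ObstructionVanishesAt [IsManifold (𝓡 n) ∞ M] (h : BilinField n M) (K : EndField n M) (p : Fin n → M → ℝ)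
    (A B C : Fin n) (x : M) : Prop :=
  ∀ X : Fin n → VField n M, IsSmoothUnitEigenframeNear h K p X x →
    ∀ γ : Fin n → Fin n → Fin n → ℝ, AreStructureCoeffsAt X γ x → (γ A B C) ^ 2 = 0

variable [IsManifold (𝓡 n) ∞ M]

/-- Non-degenerate quiescent initial data on the singularity for the Einstein-scalar field
equations. -/
structure IsQuiescentData (h : SmoothMetric n M) (K : EndField n M) (Φa Φb : M → ℝ) : Prop where
  three_le : 3 ≤ n
  smooth_K : ContMDiff (𝓡 n)
    ((𝓡 n).prod 𝓘(ℝ, EuclideanSpace ℝ (Fin n) →L[ℝ] EuclideanSpace ℝ (Fin n))) ∞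
    (fun x => TotalSpace.mk' (EuclideanSpace ℝ (Fin n) →L[ℝ] EuclideanSpace ℝ (Fin n))
      (E := fun x : M => TangentSpace (𝓡 n) x →L[ℝ] TangentSpace (𝓡 n) x) x (K x))
  smooth_Φa : ContMDiff (𝓡 n) 𝓘(ℝ) ∞ Φa
  smooth_Φb : ContMDiff (𝓡 n) 𝓘(ℝ) ∞ Φb
  trace_eq : ∀ x, endTrace (K x) = 1
  symm : ∀ x (v w : TangentSpace (𝓡 n) x), h.inner x (K x v) w = h.inner x v (K x w)
  hamiltonian : ∀ x, endTrace (K x ∘L K x) + Φa x ^ 2 = 1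
  momentum : DivEq h.inner K (fun x => Φa x • mvfderiv (𝓡 n) Φb x)
  nondegenerate : ∃ p : Fin n → M → ℝ, AreOrderedEigenvalues K p
  obstruction : ∀ p : Fin n → M → ℝ, AreOrderedEigenvalues K p → ∀ (x : M) (A B C : Fin n),
    1 + p A x - p B x - p C x ≤ 0 → ∀ᶠ y in 𝓝 x, ObstructionVanishesAt h.inner K p A B C y

end Data

section VelocityDominated

variable {n : ℕ} {M : Type*} [TopologicalSpace M] [ChartedSpace (EuclideanSpace ℝ (Fin n)) M]

/-- Joint smoothness in `(t, x) ∈ (0, ∞) × M` of a family of covariant `2`-tensor fields. -/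
def SmoothFamily (b : ℝ → BilinField n M) [IsManifold (𝓡 n) ∞ M] : Prop :=
  ContMDiffOn (𝓘(ℝ).prod (𝓡 n))
    ((𝓡 n).prod 𝓘(ℝ, EuclideanSpace ℝ (Fin n) →L[ℝ] EuclideanSpace ℝ (Fin n) →L[ℝ] ℝ)) ∞
    (fun q : ℝ × M => TotalSpace.mk'
      (EuclideanSpace ℝ (Fin n) →L[ℝ] EuclideanSpace ℝ (Fin n) →L[ℝ] ℝ)
      (E := fun x : M => TangentSpace (𝓡 n) x →L[ℝ] TangentSpace (𝓡 n) x →L[ℝ] ℝ)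
      q.2 (b q.1 q.2))
    (Ioi 0 ×ˢ univ)

/-- The second fundamental form as a `(1,1)`-tensor, `k^a_b = g^{ac} k_{cb}`, at time `t`. -/
def mixedK (g k : ℝ → BilinField n M) (t : ℝ) : EndField n M :=
  fun x => raiseIndex (g t x) (k t x)

/-- The velocity dominated energy density `ρ = (∂_t φ)² / 2`. -/
def vdRho (φ : ℝ → M → ℝ) (t : ℝ) (x : M) : ℝ :=
  (1 / 2) * deriv (fun s => φ s x) t ^ 2

/-- The velocity dominated momentum density `j_b = - ∂_t φ · e_b(φ)`. -/
def vdJ (φ : ℝ → M → ℝ) (t : ℝ) : CovField n M :=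
  fun x => -(deriv (fun s => φ s x) t • mvfderiv (𝓡 n) (φ t) x)

/-- The velocity dominated stress tensor `S_ab = (∂_t φ)² g_ab / 2`. -/
def vdS (g : ℝ → BilinField n M) (φ : ℝ → M → ℝ) (t : ℝ) : BilinField n M :=
  fun x => ((1 / 2) * deriv (fun s => φ s x) t ^ 2) • g t x

variable [IsManifold (𝓡 n) ∞ M]

/-- `(g, k, φ)` is a smooth solution on `(0, ∞) × M` of the velocity dominated Einstein-scalar
field equations in `n + 1` dimensions, in units in which Einstein's equations read
`Ric - (1/2) S g = T`. -/
structure IsVelocityDominatedSolution (g k : ℝ → BilinField n M) (φ : ℝ → M → ℝ) : Prop where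
  smooth_g : SmoothFamily g
  smooth_k : SmoothFamily k
  smooth_φ : ContMDiffOn (𝓘(ℝ).prod (𝓡 n)) 𝓘(ℝ) ∞ (fun q : ℝ × M => φ q.1 q.2)
    (Ioi 0 ×ˢ univ)
  symm_g : ∀ t > 0, ∀ x v w, g t x v w = g t x w v
  pos_g : ∀ t > 0, ∀ x v, v ≠ 0 → 0 < g t x v v
  symm_k : ∀ t > 0, ∀ x v w, k t x v w = k t x w v
  /-- Hamiltonian constraint `- k_ij k^ij + (tr k)² = 2 ρ`; since `k` is symmetric, `k_ij k^ij` is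
  the trace of the square of `k^a_b`. -/
  hamiltonian : ∀ t > 0, ∀ x,
    -endTrace (mixedK g k t x ∘L mixedK g k t x) + endTrace (mixedK g k t x) ^ 2 =
      2 * vdRho φ t x
  /-- Momentum constraint `∇^a k_ab - e_b (tr k) = j_b`. -/
  momentum : ∀ t > 0, DivEq (g t) (mixedK g k t)
    (fun x => mvfderiv (𝓡 n) (fun y => endTrace (mixedK g k t y)) x + vdJ φ t x)
  /-- `∂_t g_ab = - 2 k_ab`. -/
  evol_g : ∀ t > 0, ∀ x v w, HasDerivAt (fun s => g s x v w) (-2 * k t x v w) t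
  /-- `∂_t k^a_b = (tr k) k^a_b - (S^a_b - (tr S) δ^a_b / (n - 1)) - ρ δ^a_b / (n - 1)`. -/
  evol_k : ∀ t > 0, ∀ (x : M) (v : TangentSpace (𝓡 n) x),
    HasDerivAt (fun s => mixedK g k s x v)
      (endTrace (mixedK g k t x) • mixedK g k t x v
        - (raiseIndex (g t x) (vdS g φ t x) v
          - (endTrace (raiseIndex (g t x) (vdS g φ t x)) / ((n : ℝ) - 1)) • v)
        - (vdRho φ t x / ((n : ℝ) - 1)) • v) t
  /-- `∂_t² φ - (tr k) ∂_t φ = 0`. -/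
  wave : ∀ t > 0, ∀ x, HasDerivAt (fun s => deriv (fun r => φ r x) s)
    (endTrace (mixedK g k t x) * deriv (fun r => φ r x) t) t

/-- The tensor field `∑_A f_A Y^A ⊗ Y^A`. -/
def diagTensor (f : Fin n → M → ℝ) (Y : Fin n → CovField n M) : BilinField n M :=
  fun x => ∑ A, f A x • (Y A x).smulRight (Y A x)

end VelocityDominated

end

/-! The weights cancel when an index is raised: `k^a_b = -t⁻¹ K` (`IsEigenframe.mixedK_eq`). Hence
`tr k = -1/t`, and with `∂_t φ = Φa / t` the Hamiltonian constraint, the evolution of `k^a_b` and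
the wave equation reduce to scalar identities using `tr K = 1` and `tr K² + Φa² = 1`. The equation
for `∂_t g` is the derivative of a power.

The momentum constraint carries the geometry. If `D` is the Levi-Civita connection of `h`, that of
`g = ∑ f_A Y^A ⊗ Y^A` is `D + C`, with `C` obtained from `Dg` by Koszul's formula. As `K` is
diagonal in the same frame, only diagonal components of `C` enter the traces, and
`IsEigenframe.exists_leviCivita_diagTensor` gives `(div_g K - div_h K)(w) = ½ ∑_A (d log f_A (K w) -
p_A d log f_A (w))`. For `f_A = t^(2 p_A)` one has `d log f_A = 2 ln t dp_A`. Differentiating the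
two algebraic constraints gives `∑ dp_A = 0` and `∑ p_A dp_A = -Φa dΦa`, so `div_g K = Φa dΦb + ln t
Φa dΦa = Φa dφ`. Multiplication by `-1/t` gives `j`, and `tr k` is constant in space.

Regularity has to be earned, since `p`, `X`, `Y` are given only pointwise and the signs of `X` may
jump. Simple eigenvalues make the eigenpairs locally smooth by the inverse function theorem
(`exists_contDiffAt_eigenpair`, `exists_smooth_eigenframe`), and `Y^A ⊗ Y^A` depends only on the
eigenline. -/

section DualFrame

/-! ### Linear algebra of a frame and its dual. -/

section

variable {V : Type*} [AddCommGroup V] [Module ℝ V] [TopologicalSpace V] [ContinuousSMul ℝ V]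

/-- Evaluation of functionals at a vector. -/
def evalCLM (v : V) : (V →L[ℝ] ℝ) →L[ℝ] ℝ where
  toFun α := α v
  map_add' _ _ := rfl
  map_smul' _ _ := rfl
  cont := continuous_eval_const v

@[simp] theorem evalCLM_apply (v : V) (α : V →L[ℝ] ℝ) : evalCLM v α = α v := rfl

end

variable {n : ℕ} {V : Type*} [AddCommGroup V] [Module ℝ V] [TopologicalSpace V]
  [FiniteDimensional ℝ V]

theorem dualFrame_expansion {X : Fin n → V} {Y : Fin n → V →L[ℝ] ℝ}
    (hV : Module.finrank ℝ V = n) (hYX : ∀ A B, Y A (X B) = if A = B then 1 else 0) (v : V) :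
    ∑ A, Y A v • X A = v := by
  have hli : LinearIndependent ℝ X := by
    rw [Fintype.linearIndependent_iff]
    intro c hc A
    simpa [hYX] using congrArg (Y A) hc
  let b := basisOfLinearIndependentOfCardEqFinrank' X hli (by simpa using hV.symm)
  have hb : ∀ A, b A = X A := fun A => by simp [b]
  have key : (∑ A, ((Y A).toLinearMap).smulRight (X A)) = LinearMap.id := by
    refine b.ext fun B => ?_
    simp [hb, hYX]
  simpa using congrArg (fun L : V →ₗ[ℝ] V => L v) key

theorem trace_eq_sum_dualFrame {X : Fin n → V} {Y : Fin n → V →L[ℝ] ℝ}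
    (hV : Module.finrank ℝ V = n) (hYX : ∀ A B, Y A (X B) = if A = B then 1 else 0)
    (T : V →ₗ[ℝ] V) : LinearMap.trace ℝ V T = ∑ A, Y A (T (X A)) := by
  have hli : LinearIndependent ℝ X := by
    rw [Fintype.linearIndependent_iff]
    intro c hc A
    simpa [hYX] using congrArg (Y A) hc
  let b := basisOfLinearIndependentOfCardEqFinrank' X hli (by simpa using hV.symm)
  have hb : ∀ A, b A = X A := fun A => by simp [b]
  have hrepr : ∀ A v, b.repr v A = Y A v := by
    intro A v
    conv_rhs => rw [← b.sum_repr v]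
    simp [hb, hYX]
  rw [LinearMap.trace_eq_matrix_trace ℝ b, Matrix.trace]
  simp [LinearMap.toMatrix_apply, hrepr, hb]

variable [IsTopologicalAddGroup V] [ContinuousSMul ℝ V]

/-- The two-sided inverse of `∑ f_A Y^A ⊗ Y^A` is `∑ f_A⁻¹ X_A ⊗ X_A`, which makes index raising
explicit. -/
theorem inverse_sum_dualFrame_apply {X : Fin n → V} {Y : Fin n → V →L[ℝ] ℝ}
    (hV : Module.finrank ℝ V = n) (hYX : ∀ A B, Y A (X B) = if A = B then 1 else 0)
    {f : Fin n → ℝ} (hf : ∀ A, f A ≠ 0) (α : V →L[ℝ] ℝ) :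
    (∑ A, f A • (Y A).smulRight (Y A)).inverse α = ∑ A, ((f A)⁻¹ * α (X A)) • X A := by
  let G : (V →L[ℝ] ℝ) →L[ℝ] V :=
    ∑ A, (f A)⁻¹ • (evalCLM (X A)).smulRight (X A)
  have h : (∑ A, f A • (Y A).smulRight (Y A)).inverse = G := by
    apply ContinuousLinearMap.inverse_eq
    · ext β v
      simp only [G, ContinuousLinearMap.comp_apply, sum_apply,
        smul_apply, ContinuousLinearMap.smulRight_apply, map_sum, map_smul,
        evalCLM_apply, hYX, ContinuousLinearMap.id_apply]
      conv_rhs => rw [← dualFrame_expansion hV hYX v]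
      simp only [map_sum, map_smul, smul_eq_mul, ite_mul, one_mul, zero_mul, mul_ite, mul_zero,
        Finset.sum_ite_eq', Finset.mem_univ, if_true]
      refine Finset.sum_congr rfl fun A _ => ?_
      field_simp [hf A]
    · ext v
      simp only [G, ContinuousLinearMap.comp_apply, sum_apply,
        smul_apply, ContinuousLinearMap.smulRight_apply,
        evalCLM_apply, hYX, ContinuousLinearMap.id_apply]
      conv_rhs => rw [← dualFrame_expansion hV hYX v]
      refine Finset.sum_congr rfl fun A _ => ?_
      simp [smul_smul, hf A]
  rw [h]
  simp [G, smul_smul]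

/-- Koszul's formula: a trilinear form `N` (the covariant derivative of a nondegenerate diagonal
bilinear form) determines the difference tensor of the Levi-Civita connection. -/
theorem exists_koszul_difference [T2Space V] {X : Fin n → V} {Y : Fin n → V →L[ℝ] ℝ}
    (hV : Module.finrank ℝ V = n) (hYX : ∀ A B, Y A (X B) = if A = B then 1 else 0)
    {f : Fin n → ℝ} (hf : ∀ A, f A ≠ 0) {N : V → V → V → ℝ}
    (hN₁ : ∀ v w, IsLinearMap ℝ fun u => N u v w) (hN₂ : ∀ u w, IsLinearMap ℝ fun v => N u v w)
    (hN₃ : ∀ u v, IsLinearMap ℝ fun w => N u v w) :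
    ∃ C : V →L[ℝ] V →L[ℝ] V, ∀ u v w,
      (∑ A, f A • (Y A).smulRight (Y A)) (C u v) w = (N u v w + N v u w - N w u v) / 2 := by
  -- For fixed `u`, `v` the Koszul expression is a linear form in `w`; its index is raised with the
  -- inverse weights `(f A)⁻¹`.
  let C₀ : V →ₗ[ℝ] V →ₗ[ℝ] V := LinearMap.mk₂ ℝ
    (fun u v => ∑ A, ((f A)⁻¹ * ((N u v (X A) + N v u (X A) - N (X A) u v) / 2)) • X A)
    (by
      intro u u' v
      rw [← Finset.sum_add_distrib]
      refine Finset.sum_congr rfl fun A _ => ?_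
      rw [← add_smul, (hN₁ v (X A)).map_add, (hN₂ v (X A)).map_add, (hN₂ (X A) v).map_add]
      congr 1; ring)
    (by
      intro c u v
      rw [Finset.smul_sum]
      refine Finset.sum_congr rfl fun A _ => ?_
      rw [smul_smul, (hN₁ v (X A)).map_smul, (hN₂ v (X A)).map_smul, (hN₂ (X A) v).map_smul]
      simp only [smul_eq_mul]
      congr 1; ring)
    (by
      intro u v v'
      rw [← Finset.sum_add_distrib]
      refine Finset.sum_congr rfl fun A _ => ?_
      rw [← add_smul, (hN₁ u (X A)).map_add, (hN₂ u (X A)).map_add, (hN₃ (X A) u).map_add]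
      congr 1; ring)
    (by
      intro c u v
      rw [Finset.smul_sum]
      refine Finset.sum_congr rfl fun A _ => ?_
      rw [smul_smul, (hN₁ u (X A)).map_smul, (hN₂ u (X A)).map_smul, (hN₃ (X A) u).map_smul]
      simp only [smul_eq_mul]
      congr 1; ring)
  refine ⟨C₀.toContinuousBilinearMap, fun u v w => ?_⟩
  let L : V →ₗ[ℝ] ℝ := (1 / 2 : ℝ) • (((hN₃ u v).mk') + ((hN₃ v u).mk') - ((hN₁ u v).mk'))
  have hL : ∀ z, L z = (N u v z + N v u z - N z u v) / 2 := by
    intro z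
    simp only [L, LinearMap.smul_apply, LinearMap.add_apply, LinearMap.sub_apply,
      IsLinearMap.mk'_apply, smul_eq_mul]
    ring
  rw [← hL]
  have hYs : ∀ (c : Fin n → ℝ) (A : Fin n), Y A (∑ B, c B • X B) = c A := fun c A => by
    simp [hYX]
  conv_rhs => rw [← dualFrame_expansion hV hYX w, map_sum]
  simp only [C₀, LinearMap.toContinuousBilinearMap_apply, LinearMap.mk₂_apply, sum_apply,
    smul_apply, ContinuousLinearMap.smulRight_apply, hYs]
  refine Finset.sum_congr rfl fun A _ => ?_
  rw [map_smul, hL]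
  simp only [smul_eq_mul]
  field_simp [hf A]

end DualFrame

/-! ### Smooth dependence of simple eigenpairs. -/

section SimpleEigenvalue

variable {E : Type*} [NormedAddCommGroup E] [NormedSpace ℝ E] [FiniteDimensional ℝ E]

/-- Inverse function theorem for `(K, v, μ) ↦ (K, K v - μ v, l v)`; the form `l` fixes the scaling
of the eigenvector, and `hsimple` is exactly injectivity of the derivative in `(v, μ)`. -/
theorem exists_contDiffAt_eigenpair (K₀ : E →L[ℝ] E) (v₀ : E) (μ₀ : ℝ) (l : E →L[ℝ] ℝ)
    (h₀ : K₀ v₀ = μ₀ • v₀)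
    (hsimple : ∀ (v : E) (c : ℝ), K₀ v - μ₀ • v = c • v₀ → l v = 0 → v = 0 ∧ c = 0) :
    ∃ (W : (E →L[ℝ] E) → E) (μ : (E →L[ℝ] E) → ℝ),
      ContDiffAt ℝ ∞ W K₀ ∧ ContDiffAt ℝ ∞ μ K₀ ∧ W K₀ = v₀ ∧ μ K₀ = μ₀ ∧
      ∀ᶠ K in 𝓝 K₀, K (W K) = μ K • W K := by
  let F : (E →L[ℝ] E) × E × ℝ → (E →L[ℝ] E) × E × ℝ :=
    fun q => (q.1, q.1 q.2.1 - q.2.2 • q.2.1, l q.2.1)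
  let a : (E →L[ℝ] E) × E × ℝ := (K₀, v₀, μ₀)
  have hF : ContDiff ℝ ∞ F := by
    refine contDiff_fst.prodMk (ContDiff.prodMk ?_ ?_)
    · exact (contDiff_fst.clm_apply contDiff_snd.fst).sub (contDiff_snd.snd.smul contDiff_snd.fst)
    · exact l.contDiff.comp contDiff_snd.fst
  have hFd : HasFDerivAt F (fderiv ℝ F a) a :=
    (hF.differentiable (by simp) a).hasFDerivAt
  have hval : ∀ q : (E →L[ℝ] E) × E × ℝ, fderiv ℝ F a q =
      (q.1, (K₀ q.2.1 + q.1 v₀) - (μ₀ • q.2.1 + q.2.2 • v₀), l q.2.1) := by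
    intro q
    have h1 : HasFDerivAt (fun q : (E →L[ℝ] E) × E × ℝ => q.1) (ContinuousLinearMap.fst ℝ _ _) a :=
      hasFDerivAt_fst
    have h2 : HasFDerivAt (fun q : (E →L[ℝ] E) × E × ℝ => q.2.1)
      ((ContinuousLinearMap.fst ℝ _ _).comp (ContinuousLinearMap.snd ℝ _ _)) a :=
      hasFDerivAt_fst.comp a hasFDerivAt_snd
    have h3 : HasFDerivAt (fun q : (E →L[ℝ] E) × E × ℝ => q.2.2)
      ((ContinuousLinearMap.snd ℝ _ _).comp (ContinuousLinearMap.snd ℝ _ _)) a :=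
      hasFDerivAt_snd.comp a hasFDerivAt_snd
    have h4 := h1.prodMk (((h1.clm_apply h2).sub (h3.smul h2)).prodMk (l.hasFDerivAt.comp a h2))
    have h5 : HasFDerivAt F _ a := h4
    rw [h5.fderiv]
    simp [a]
  have hinj : Function.Injective (fderiv ℝ F a) := by
    rw [injective_iff_map_eq_zero]
    rintro ⟨k, v, c⟩ hq
    rw [hval] at hq
    simp only [Prod.mk_eq_zero] at hq
    obtain ⟨hk, h1, h2⟩ := hq
    subst hk
    obtain ⟨hv, hc⟩ := hsimple v c (by
      simp only [zero_apply, add_zero] at h1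
      rw [← sub_eq_zero, ← h1]; abel) h2
    simp [hv, hc]
  let L : ((E →L[ℝ] E) × E × ℝ) ≃L[ℝ] ((E →L[ℝ] E) × E × ℝ) :=
    (LinearEquiv.ofInjectiveEndo (fderiv ℝ F a).toLinearMap hinj).toContinuousLinearEquiv
  have hL : (L : ((E →L[ℝ] E) × E × ℝ) →L[ℝ] ((E →L[ℝ] E) × E × ℝ)) = fderiv ℝ F a := by
    rfl
  have hFd' : HasFDerivAt F (L : ((E →L[ℝ] E) × E × ℝ) →L[ℝ] ((E →L[ℝ] E) × E × ℝ)) a := by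
    rw [hL]; exact hFd
  have hn : (∞ : WithTop ℕ∞) ≠ 0 := by simp
  let G := hF.contDiffAt.localInverse hFd' hn
  have hG : ContDiffAt ℝ ∞ G (F a) := hF.contDiffAt.to_localInverse hFd' hn
  have hGa : G (F a) = a := hF.contDiffAt.localInverse_apply_image hFd' hn
  have hFG : ∀ᶠ q in 𝓝 (F a), F (G q) = q :=
    (hF.contDiffAt.hasStrictFDerivAt' hFd' hn).eventually_right_inverse
  -- The preimage of this slice consists of the eigenpairs normalized by `l v = l v₀`.
  let ι : (E →L[ℝ] E) → (E →L[ℝ] E) × E × ℝ := fun K => (K, 0, l v₀)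
  have hι : ContDiff ℝ ∞ ι := contDiff_id.prodMk contDiff_const
  have hιa : ι K₀ = F a := by simp [ι, F, a, h₀]
  have hGι : ContDiffAt ℝ ∞ (fun K => G (ι K)) K₀ :=
    ContDiffAt.comp K₀ (by rw [hιa]; exact hG) hι.contDiffAt
  refine ⟨fun K => (G (ι K)).2.1, fun K => (G (ι K)).2.2, ?_, ?_, ?_, ?_, ?_⟩
  · exact contDiffAt_fst.comp K₀ (contDiffAt_snd.comp K₀ hGι)
  · exact contDiffAt_snd.comp K₀ (contDiffAt_snd.comp K₀ hGι)
  · simp [hιa, hGa, a]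
  · simp [hιa, hGa, a]
  · have ht : Tendsto ι (𝓝 K₀) (𝓝 (F a)) := hιa ▸ hι.continuous.continuousAt
    filter_upwards [ht.eventually hFG] with K hK
    have h1 : (G (ι K)).1 = K := congrArg Prod.fst hK
    have h2 : (G (ι K)).1 (G (ι K)).2.1 - (G (ι K)).2.2 • (G (ι K)).2.1 = 0 :=
      congrArg (fun q => q.2.1) hK
    rw [h1] at h2
    exact sub_eq_zero.mp h2

end SimpleEigenvalue

/-- Identifies smoothly continued eigenvalues with the ordered ones, on which no continuity is
assumed. -/
theorem strictMono_fin_eq_of_forall_mem_range {n : ℕ} {p q : Fin n → ℝ} (hp : StrictMono p)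
    (hq : StrictMono q) (h : ∀ A, ∃ B, q A = p B) : q = p := by
  choose σ hσ using h
  have hmono : StrictMono σ := fun A B hAB => by
    have := hq hAB
    rw [hσ, hσ] at this
    exact hp.lt_iff_lt.mp this
  have hid : σ = id := by
    rw [← hmono.range_inj strictMono_id,
      (Finite.injective_iff_surjective.mp hmono.injective).range_eq, range_id]
  funext A
  rw [hσ, hid, id]

/-! ### Eigenvectors of an endomorphism diagonal in a frame. -/

section Frame

variable {n : ℕ} {V : Type*} [AddCommGroup V] [Module ℝ V] [TopologicalSpace V]
  [FiniteDimensional ℝ V]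

theorem eigenvalue_mem_of_dualFrame {X : Fin n → V} {Y : Fin n → V →L[ℝ] ℝ}
    (hV : Module.finrank ℝ V = n) (hYX : ∀ A B, Y A (X B) = if A = B then 1 else 0)
    {K : V →ₗ[ℝ] V} {p : Fin n → ℝ} (hK : ∀ A, K (X A) = p A • X A) {μ : ℝ} {v : V} (hv : v ≠ 0)
    (h : K v = μ • v) : ∃ A, μ = p A ∧ Y A v ≠ 0 := by
  have hex : ∃ A, Y A v ≠ 0 := by
    by_contra! hc
    apply hv
    rw [← dualFrame_expansion hV hYX v]
    simp [hc]
  obtain ⟨A, hA⟩ := hex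
  refine ⟨A, ?_, hA⟩
  have h1 : Y A (K v) = p A * Y A v := by
    conv_lhs => rw [← dualFrame_expansion hV hYX v]
    simp [hK, hYX, mul_comm]
  rw [h, map_smul, smul_eq_mul] at h1
  exact mul_right_cancel₀ hA h1

theorem eq_smul_of_eigenvector {X : Fin n → V} {Y : Fin n → V →L[ℝ] ℝ}
    (hV : Module.finrank ℝ V = n) (hYX : ∀ A B, Y A (X B) = if A = B then 1 else 0)
    {K : V →ₗ[ℝ] V} {p : Fin n → ℝ} (hp : Function.Injective p) (hK : ∀ A, K (X A) = p A • X A)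
    {A : Fin n} {v : V} (h : K v = p A • v) : v = Y A v • X A := by
  conv_lhs => rw [← dualFrame_expansion hV hYX v]
  refine Finset.sum_eq_single A (fun B _ hB => ?_) (by simp)
  have h1 : Y B (K v) = p B * Y B v := by
    conv_lhs => rw [← dualFrame_expansion hV hYX v]
    simp [hK, hYX, mul_comm]
  rw [h, map_smul, smul_eq_mul] at h1
  have h2 : (p A - p B) * Y B v = 0 := by linarith
  rcases mul_eq_zero.mp h2 with h3 | h3
  · exact absurd (hp (sub_eq_zero.mp h3)).symm hB
  · simp [h3]

end Frame

/-! ### Smooth local eigenvector fields of `K`. -/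

section Geometry

variable {n : ℕ} {M : Type*} [TopologicalSpace M] [ChartedSpace (EuclideanSpace ℝ (Fin n)) M]

instance (x : M) : FiniteDimensional ℝ (TangentSpace (𝓡 n) x) :=
  inferInstanceAs (FiniteDimensional ℝ (EuclideanSpace ℝ (Fin n)))

instance (x : M) : T2Space (TangentSpace (𝓡 n) x) :=
  inferInstanceAs (T2Space (EuclideanSpace ℝ (Fin n)))

theorem finrank_tangentSpace (x : M) : Module.finrank ℝ (TangentSpace (𝓡 n) x) = n :=
  finrank_euclideanSpace_fin

variable [IsManifold (𝓡 n) ∞ M]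

theorem isUnitEigenframeAt_orthonormal {h : SmoothMetric n M} {K : EndField n M}
    (hsymm : ∀ x (v w : TangentSpace (𝓡 n) x), h.inner x (K x v) w = h.inner x v (K x w))
    {p : Fin n → M → ℝ} {x : M} (hp : StrictMono fun A => p A x) {X : Fin n → VField n M}
    (hX : IsUnitEigenframeAt h.inner K p X x) (A B : Fin n) :
    h.inner x (X A x) (X B x) = if A = B then 1 else 0 := by
  split_ifs with hAB
  · subst hAB; exact (hX A).2
  · have h1 := hsymm x (X A x) (X B x)
    rw [(hX A).1, (hX B).1, map_smul, map_smul] at h1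
    simp only [smul_apply, smul_eq_mul] at h1
    have h2 : (p A x - p B x) * h.inner x (X A x) (X B x) = 0 := by linarith
    rcases mul_eq_zero.mp h2 with h3 | h3
    · exact absurd (hp.injective (sub_eq_zero.mp h3)) hAB
    · exact h3

/-- In a trivialization at `x₀`, `K` becomes a smooth matrix-valued map, to which the smooth
eigenpairs of a simple eigenvalue are composed. The fields `V` are not normalized away from `x₀`. -/
theorem exists_smooth_eigenframe {h : SmoothMetric n M} {K : EndField n M}
    (hK : ContMDiff (𝓡 n)
      ((𝓡 n).prod 𝓘(ℝ, EuclideanSpace ℝ (Fin n) →L[ℝ] EuclideanSpace ℝ (Fin n))) ∞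
      (fun x => TotalSpace.mk' (EuclideanSpace ℝ (Fin n) →L[ℝ] EuclideanSpace ℝ (Fin n))
        (E := fun x : M => TangentSpace (𝓡 n) x →L[ℝ] TangentSpace (𝓡 n) x) x (K x)))
    (hsymm : ∀ x (v w : TangentSpace (𝓡 n) x), h.inner x (K x v) w = h.inner x v (K x w))
    {p : Fin n → M → ℝ} (hp : AreOrderedEigenvalues K p) {X : Fin n → VField n M}
    (hX : ∀ x, IsUnitEigenframeAt h.inner K p X x) (x₀ : M) :
    (∀ A, ContMDiffAt (𝓡 n) 𝓘(ℝ) ∞ (p A) x₀) ∧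
    ∃ V : Fin n → VField n M, (∀ A, VFieldSmoothAt (V A) x₀) ∧ (∀ A, V A x₀ = X A x₀) ∧
      ∀ᶠ y in 𝓝 x₀, ∀ A, V A y ≠ 0 ∧ K y (V A y) = p A y • V A y := by
  let E := EuclideanSpace ℝ (Fin n)
  let e := trivializationAt E (TangentSpace (𝓡 n) (M := M)) x₀
  have hx₀ : x₀ ∈ e.baseSet := mem_baseSet_trivializationAt E (TangentSpace (𝓡 n)) x₀
  have horth : ∀ x A B, h.inner x (X A x) (X B x) = if A = B then 1 else 0 := fun x A B =>
    isUnitEigenframeAt_orthonormal hsymm (hp x).1 (hX x) A B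
  let Kt : M → E →L[ℝ] E := fun y => ContinuousLinearMap.inCoordinates E (TangentSpace (𝓡 n)) E
    (TangentSpace (𝓡 n)) x₀ y x₀ y (K y)
  have hKt : ContMDiffAt (𝓡 n) 𝓘(ℝ, E →L[ℝ] E) ∞ Kt x₀ :=
    ((contMDiffAt_hom_bundle _).mp (hK x₀)).2
  have hKt_symm : ∀ y ∈ e.baseSet, ∀ w, e.symmL ℝ y (Kt y w) = K y (e.symmL ℝ y w) := by
    intro y hy w
    simp only [Kt]
    rw [ContinuousLinearMap.inCoordinates_eq hy hy]
    simp only [ContinuousLinearMap.comp_apply, ContinuousLinearEquiv.coe_coe]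
    rw [← e.symm_continuousLinearEquivAt_eq hy]
    exact (e.continuousLinearEquivAt ℝ y hy).symm_apply_apply _
  let φ := e.continuousLinearEquivAt ℝ x₀ hx₀
  have hφs : ∀ w, φ.symm w = e.symmL ℝ x₀ w := fun w =>
    congrFun (e.symm_continuousLinearEquivAt_eq hx₀) w
  have hpair : ∀ A, ∃ (W : (E →L[ℝ] E) → E) (μ : (E →L[ℝ] E) → ℝ),
      ContDiffAt ℝ ∞ W (Kt x₀) ∧ ContDiffAt ℝ ∞ μ (Kt x₀) ∧ W (Kt x₀) = φ (X A x₀) ∧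
      μ (Kt x₀) = p A x₀ ∧ ∀ᶠ L in 𝓝 (Kt x₀), L (W L) = μ L • W L := by
    intro A
    have hKX : φ.symm (Kt x₀ (φ (X A x₀))) = φ.symm (p A x₀ • φ (X A x₀)) := by
      rw [hφs, hKt_symm x₀ hx₀, ← hφs, φ.symm_apply_apply, (hX x₀ A).1, map_smul,
        φ.symm_apply_apply]
    refine exists_contDiffAt_eigenpair (Kt x₀) (φ (X A x₀)) (p A x₀)
      ((h.inner x₀ (X A x₀)) ∘L (φ.symm : E →L[ℝ] TangentSpace (𝓡 n) x₀)) (φ.symm.injective hKX) ?_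
    intro v c hv hl
    have hl' : h.inner x₀ (X A x₀) (φ.symm v) = 0 := hl
    have hv' : K x₀ (φ.symm v) - p A x₀ • φ.symm v = c • X A x₀ := by
      have := congrArg φ.symm hv
      rw [map_sub, map_smul, map_smul, φ.symm_apply_apply, hφs (Kt x₀ v), hKt_symm x₀ hx₀,
        ← hφs] at this
      exact this
    -- Pairing with `X A` kills the left side by symmetry of `K`, so no generalized eigenvector
    -- occurs.
    have hc : c = 0 := by
      have := congrArg (h.inner x₀ (X A x₀)) hv'
      rw [map_sub, map_smul, map_smul, hl', ← hsymm, (hX x₀ A).1, map_smul, smul_apply, hl',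
        horth] at this
      simpa using this.symm
    refine ⟨?_, hc⟩
    rw [hc, zero_smul, sub_eq_zero] at hv'
    have := eq_smul_of_eigenvector (finrank_tangentSpace x₀) (Y := fun B => h.inner x₀ (X B x₀))
      (horth x₀) (hp x₀).1.injective (K := (K x₀).toLinearMap) (fun B => (hX x₀ B).1) hv'
    rw [hl', zero_smul] at this
    simpa using this
  choose W μ hW hμ hW₀ hμ₀ hWμ using hpair
  let V : Fin n → VField n M := fun A y => e.symmL ℝ y (W A (Kt y))
  have hWK : ∀ A, ContMDiffAt (𝓡 n) 𝓘(ℝ, E) ∞ (fun y => W A (Kt y)) x₀ := fun A =>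
    (hW A).contMDiffAt.comp x₀ hKt
  have hμK : ∀ A, ContMDiffAt (𝓡 n) 𝓘(ℝ) ∞ (fun y => μ A (Kt y)) x₀ := fun A =>
    (hμ A).contMDiffAt.comp x₀ hKt
  have hbase : ∀ᶠ y in 𝓝 x₀, y ∈ e.baseSet := e.open_baseSet.mem_nhds hx₀
  have hVne : ∀ᶠ y in 𝓝 x₀, ∀ A, V A y ≠ 0 := by
    refine eventually_all.mpr fun A => ?_
    have hX0 : φ (X A x₀) ≠ 0 := by
      intro h0
      have : X A x₀ = 0 := by simpa using h0
      have h1 := horth x₀ A A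
      simp [this] at h1
    have h1 : ∀ᶠ y in 𝓝 x₀, W A (Kt y) ≠ 0 :=
      (hWK A).continuousAt.eventually_ne (by rw [hW₀]; exact hX0)
    filter_upwards [h1, hbase] with y hy hyb h0
    apply hy
    have : (e.continuousLinearEquivAt ℝ y hyb).symm (W A (Kt y)) = 0 := by
      rw [e.symm_continuousLinearEquivAt_eq hyb]; exact h0
    exact (e.continuousLinearEquivAt ℝ y hyb).symm.injective (this.trans (map_zero _).symm)
  have hVeig : ∀ᶠ y in 𝓝 x₀, ∀ A, K y (V A y) = μ A (Kt y) • V A y := by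
    refine eventually_all.mpr fun A => ?_
    filter_upwards [hKt.continuousAt.eventually (hWμ A), hbase] with y hy hyb
    simp only [V]
    rw [← hKt_symm y hyb, hy, map_smul]
  -- The strict order at `x₀` is an open condition on the continuous `μ A`.
  have hmono : ∀ᶠ y in 𝓝 x₀, StrictMono fun A => μ A (Kt y) := by
    have : ∀ᶠ y in 𝓝 x₀, ∀ A B : Fin n, A < B → μ A (Kt y) < μ B (Kt y) := by
      refine eventually_all.mpr fun A => eventually_all.mpr fun B => ?_
      by_cases hAB : A < B
      · have := (hμK A).continuousAt.eventually_lt (hμK B).continuousAt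
          (by rw [hμ₀, hμ₀]; exact (hp x₀).1 hAB)
        filter_upwards [this] with y hy _ using hy
      · exact Eventually.of_forall fun y h => absurd h hAB
    filter_upwards [this] with y hy A B hAB using hy A B hAB
  have hpμ : ∀ᶠ y in 𝓝 x₀, ∀ A, p A y = μ A (Kt y) := by
    filter_upwards [hVne, hVeig, hmono] with y hy1 hy2 hy3
    have := strictMono_fin_eq_of_forall_mem_range (hp y).1 hy3 fun A => by
      obtain ⟨B, hB, -⟩ := eigenvalue_mem_of_dualFrame (finrank_tangentSpace y)
        (Y := fun B => h.inner y (X B y)) (horth y) (K := (K y).toLinearMap)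
        (fun B => (hX y B).1) (hy1 A) (hy2 A)
      exact ⟨B, hB⟩
    intro A
    exact (congrFun this A).symm
  refine ⟨fun A => (hμK A).congr_of_eventuallyEq (hpμ.mono fun y hy => hy A), V, fun A => ?_,
    fun A => ?_, ?_⟩
  · rw [VFieldSmoothAt, contMDiffAt_totalSpace]
    refine ⟨contMDiffAt_id, (hWK A).congr_of_eventuallyEq ?_⟩
    filter_upwards [hbase] with y hy
    show (e ⟨y, e.symmL ℝ y (W A (Kt y))⟩).2 = W A (Kt y)
    rw [e.apply_eq_prod_continuousLinearEquivAt ℝ y hy, ← e.symm_continuousLinearEquivAt_eq hy]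
    exact (e.continuousLinearEquivAt ℝ y hy).apply_symm_apply _
  · show e.symmL ℝ x₀ (W A (Kt x₀)) = X A x₀
    rw [← hφs, hW₀, φ.symm_apply_apply]
  · filter_upwards [hVne, hVeig, hpμ] with y h1 h2 h3 A
    exact ⟨h1 A, by rw [h3 A]; exact h2 A⟩

end Geometry

/-! ### Eigenframes and the covariant derivative of diagonal tensors. -/

section Geometry

variable {n : ℕ} {M : Type*} [TopologicalSpace M] [ChartedSpace (EuclideanSpace ℝ (Fin n)) M]

theorem mdifferentiableAt_fun_sum {ι : Type*} (s : Finset ι) {f : ι → M → ℝ} {x : M}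
    (hf : ∀ i ∈ s, MDifferentiableAt (𝓡 n) 𝓘(ℝ) (f i) x) :
    MDifferentiableAt (𝓡 n) 𝓘(ℝ) (fun y => ∑ i ∈ s, f i y) x := by
  classical
  induction s using Finset.induction_on with
  | empty => simpa using mdifferentiableAt_const
  | insert a s ha ih =>
    simp only [Finset.sum_insert ha]
    exact (hf a (Finset.mem_insert_self a s)).add
      (ih fun i hi => hf i (Finset.mem_insert_of_mem hi))

theorem mvfderiv_fun_sum {ι : Type*} (s : Finset ι) {f : ι → M → ℝ} {x : M}
    (hf : ∀ i ∈ s, MDifferentiableAt (𝓡 n) 𝓘(ℝ) (f i) x) :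
    mvfderiv (𝓡 n) (fun y => ∑ i ∈ s, f i y) x = ∑ i ∈ s, mvfderiv (𝓡 n) (f i) x := by
  classical
  induction s using Finset.induction_on with
  | empty => simp [mvfderiv_const]
  | insert a s ha ih =>
    simp only [Finset.sum_insert ha]
    rw [mvfderiv_fun_add (hf a (Finset.mem_insert_self a s))
      (mdifferentiableAt_fun_sum s fun i hi => hf i (Finset.mem_insert_of_mem hi)),
      ih fun i hi => hf i (Finset.mem_insert_of_mem hi)]

theorem _root_.Filter.EventuallyEq.mvfderiv_eq {f g : M → ℝ} {x : M} (hfg : f =ᶠ[𝓝 x] g) :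
    mvfderiv (𝓡 n) f x = mvfderiv (𝓡 n) g x := by
  ext u
  change (mfderiv (𝓡 n) 𝓘(ℝ) f x u : ℝ) = mfderiv (𝓡 n) 𝓘(ℝ) g x u
  rw [hfg.mfderiv_eq]
  rfl

variable [IsManifold (𝓡 n) ∞ M]

/-- `X` is a frame of unit eigenvector fields of the smooth `h`-symmetric tensor field `K`, with
ordered eigenvalues `p`, and `Y` is the dual frame. No regularity is imposed on `p`, `X`, `Y`. -/
structure IsEigenframe (h : SmoothMetric n M) (K : EndField n M) (p : Fin n → M → ℝ)
    (X : Fin n → VField n M) (Y : Fin n → CovField n M) : Prop where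
  smooth : ContMDiff (𝓡 n)
    ((𝓡 n).prod 𝓘(ℝ, EuclideanSpace ℝ (Fin n) →L[ℝ] EuclideanSpace ℝ (Fin n))) ∞
    (fun x => TotalSpace.mk' (EuclideanSpace ℝ (Fin n) →L[ℝ] EuclideanSpace ℝ (Fin n))
      (E := fun x : M => TangentSpace (𝓡 n) x →L[ℝ] TangentSpace (𝓡 n) x) x (K x))
  symm : ∀ x (v w : TangentSpace (𝓡 n) x), h.inner x (K x v) w = h.inner x v (K x w)
  ordered : AreOrderedEigenvalues K p
  unit : ∀ x, IsUnitEigenframeAt h.inner K p X x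
  dual : ∀ A B x, Y A x (X B x) = if A = B then 1 else 0

theorem mdifferentiableAt_metric (h : SmoothMetric n M) {U Z : VField n M} {x : M}
    (hU : VFieldDiffAt U x) (hZ : VFieldDiffAt Z x) :
    MDifferentiableAt (𝓡 n) 𝓘(ℝ) (fun y => h.inner y (U y) (Z y)) x := by
  have : MDifferentiableAt (𝓡 n) ((𝓡 n).prod 𝓘(ℝ))
      (fun m ↦ TotalSpace.mk' ℝ (E := Bundle.Trivial M ℝ) m (h.inner m (U m) (Z m))) x := by
    apply MDifferentiableAt.clm_bundle_apply₂ (F₁ := EuclideanSpace ℝ (Fin n))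
      (F₂ := EuclideanSpace ℝ (Fin n))
    · exact (h.contMDiff.contMDiffAt).mdifferentiableAt (by simp)
    · exact hU
    · exact hZ
  exact ((mdifferentiableAt_totalSpace _ _).mp this).2

theorem VFieldSmoothAt.vfieldDiffAt {U : VField n M} {x : M} (hU : VFieldSmoothAt U x) :
    VFieldDiffAt U x :=
  ContMDiffAt.mdifferentiableAt hU (by simp)

namespace IsEigenframe

variable {h : SmoothMetric n M} {K : EndField n M} {p : Fin n → M → ℝ} {X : Fin n → VField n M}
  {Y : Fin n → CovField n M}

theorem orthonormal (H : IsEigenframe h K p X Y) (x : M) (A B : Fin n) :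
    h.inner x (X A x) (X B x) = if A = B then 1 else 0 :=
  isUnitEigenframeAt_orthonormal H.symm (H.ordered x).1 (H.unit x) A B

/-- Orthonormality of the eigenframe turns the dual frame into the metric dual, so smoothness of `h`
can be used for `Y`. -/
theorem dual_apply (H : IsEigenframe h K p X Y) (A : Fin n) (x : M) (v : TangentSpace (𝓡 n) x) :
    Y A x v = h.inner x (X A x) v := by
  conv_lhs => rw [← dualFrame_expansion (finrank_tangentSpace x) (Y := fun B => h.inner x (X B x))
    (H.orthonormal x) v]
  simp [H.dual]

theorem endTrace_eq (H : IsEigenframe h K p X Y) {x : M}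
    (T : TangentSpace (𝓡 n) x →L[ℝ] TangentSpace (𝓡 n) x) :
    endTrace T = ∑ A, Y A x (T (X A x)) :=
  trace_eq_sum_dualFrame (finrank_tangentSpace x) (fun A B => H.dual A B x) T.toLinearMap

theorem dual_comp (H : IsEigenframe h K p X Y) (A : Fin n) (x : M) (v : TangentSpace (𝓡 n) x) :
    Y A x (K x v) = p A x * Y A x v := by
  rw [H.dual_apply, H.dual_apply, ← H.symm, (H.unit x A).1]
  simp

theorem diagTensor_frame (H : IsEigenframe h K p X Y) (f : Fin n → M → ℝ) (A : Fin n) (x : M)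
    (v : TangentSpace (𝓡 n) x) : diagTensor f Y x v (X A x) = f A x * Y A x v := by
  simp [diagTensor, H.dual]

omit [IsManifold (𝓡 n) ∞ M] in
theorem _root_.diagTensor_apply (f : Fin n → M → ℝ) (x : M)
    (v w : TangentSpace (𝓡 n) x) :
    diagTensor f Y x v w = ∑ A, f A x * (Y A x v * Y A x w) := by
  simp [diagTensor]

/-- Near any point, `diagTensor f Y` can be written through smooth eigenvector fields. -/
theorem exists_local_frame (H : IsEigenframe h K p X Y) (x₀ : M) :
    ∃ V : Fin n → VField n M, (∀ A, VFieldSmoothAt (V A) x₀) ∧ (∀ A, V A x₀ = X A x₀) ∧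
      ∀ᶠ y in 𝓝 x₀, ∀ A, h.inner y (V A y) (V A y) ≠ 0 ∧
        (∀ w, h.inner y (V A y) w = Y A y (V A y) * Y A y w) ∧
        ∀ B, B ≠ A → Y B y (V A y) = 0 := by
  obtain ⟨-, V, hV, hVX, hloc⟩ := exists_smooth_eigenframe H.smooth H.symm H.ordered H.unit x₀
  refine ⟨V, hV, hVX, ?_⟩
  filter_upwards [hloc] with y hy A
  have hVc : V A y = Y A y (V A y) • X A y :=
    eq_smul_of_eigenvector (finrank_tangentSpace y) (fun A B => H.dual A B y)
      (H.ordered y).1.injective (K := (K y).toLinearMap) (fun B => (H.unit y B).1) (hy A).2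
  refine ⟨(h.pos y _ (hy A).1).ne', fun w => ?_, fun B hB => ?_⟩
  · conv_lhs => rw [hVc]
    simp [H.dual_apply A y w]
  · rw [hVc, map_smul, H.dual, if_neg hB, smul_zero]

theorem contMDiff_eigenvalue (H : IsEigenframe h K p X Y) (A : Fin n) :
    ContMDiff (𝓡 n) 𝓘(ℝ) ∞ (p A) := fun x =>
  (exists_smooth_eigenframe H.smooth H.symm H.ordered H.unit x).1 A

/-- `N` is the covariant derivative `D (diagTensor f Y)` at `x`. The last clause holds because each
`X A` has unit length: derivatives of the frame do not contribute to the diagonal components. -/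
theorem exists_derivative_diagTensor (H : IsEigenframe h K p X Y) {D : AffineConn n M}
    (hD : IsLeviCivita h.inner D) {f : Fin n → M → ℝ} {x : M}
    (hf : ∀ A, MDifferentiableAt (𝓡 n) 𝓘(ℝ) (f A) x) :
    ∃ N : TangentSpace (𝓡 n) x → TangentSpace (𝓡 n) x → TangentSpace (𝓡 n) x → ℝ,
      (∀ v w, IsLinearMap ℝ fun u => N u v w) ∧ (∀ u w, IsLinearMap ℝ fun v => N u v w) ∧
      (∀ u v, IsLinearMap ℝ fun w => N u v w) ∧ (∀ u v w, N u v w = N u w v) ∧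
      (∀ (u : TangentSpace (𝓡 n) x) (U Z : VField n M), VFieldDiffAt U x → VFieldDiffAt Z x →
        mvfderiv (𝓡 n) (fun y => diagTensor f Y y (U y) (Z y)) x u = N u (U x) (Z x) +
          (diagTensor f Y x (D U x u) (Z x) + diagTensor f Y x (U x) (D Z x u))) ∧
      ∀ A u, N u (X A x) (X A x) = mvfderiv (𝓡 n) (f A) x u := by
  obtain ⟨V, hV, hVX, hloc⟩ := H.exists_local_frame x
  have hVd : ∀ A, VFieldDiffAt (V A) x := fun A => (hV A).vfieldDiffAt
  -- Dividing by the squared length makes `q A • h(V A, ·) ⊗ h(V A, ·)` equal to `f A • Y A ⊗ Y A`,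
  -- whatever the sign and length of `V A`.
  let q : Fin n → M → ℝ := fun A y => f A y * (h.inner y (V A y) (V A y))⁻¹
  have hne : ∀ A, h.inner x (V A x) (V A x) ≠ 0 := fun A => (hloc.self_of_nhds A).1
  have hq : ∀ A, MDifferentiableAt (𝓡 n) 𝓘(ℝ) (q A) x := fun A =>
    (hf A).mul ((differentiableAt_inv (hne A)).mdifferentiableAt.comp x
      (mdifferentiableAt_metric h (hVd A) (hVd A)))
  have hlocq : ∀ᶠ y in 𝓝 x, ∀ v w, diagTensor f Y y v w =
      ∑ A, q A y * (h.inner y (V A y) v * h.inner y (V A y) w) := by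
    filter_upwards [hloc] with y hy v w
    rw [diagTensor_apply]
    refine Finset.sum_congr rfl fun A _ => ?_
    have h1 := (hy A).1
    simp only [q]
    rw [(hy A).2.1 (V A y)] at h1 ⊢
    rw [(hy A).2.1 v, (hy A).2.1 w]
    have h2 := left_ne_zero_of_mul h1
    field_simp
  have hx := hlocq.self_of_nhds
  let N : TangentSpace (𝓡 n) x → TangentSpace (𝓡 n) x → TangentSpace (𝓡 n) x → ℝ := fun u v w =>
    ∑ A, (mvfderiv (𝓡 n) (q A) x u * (h.inner x (V A x) v * h.inner x (V A x) w) +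
      q A x * (h.inner x (D (V A) x u) v * h.inner x (V A x) w +
        h.inner x (V A x) v * h.inner x (D (V A) x u) w))
  have hN : ∀ (u : TangentSpace (𝓡 n) x) (U Z : VField n M), VFieldDiffAt U x → VFieldDiffAt Z x →
        mvfderiv (𝓡 n) (fun y => diagTensor f Y y (U y) (Z y)) x u = N u (U x) (Z x) +
          (diagTensor f Y x (D U x u) (Z x) + diagTensor f Y x (U x) (D Z x u)) := by
    intro u U Z hU hZ
    have h1 : (fun y => diagTensor f Y y (U y) (Z y)) =ᶠ[𝓝 x]
        fun y => ∑ A, q A y * (h.inner y (V A y) (U y) * h.inner y (V A y) (Z y)) :=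
      hlocq.mono fun y hy => hy _ _
    have hVU := fun A => mdifferentiableAt_metric h (hVd A) hU
    have hVZ := fun A => mdifferentiableAt_metric h (hVd A) hZ
    have hUZ : ∀ A, MDifferentiableAt (𝓡 n) 𝓘(ℝ)
        (fun y => h.inner y (V A y) (U y) * h.inner y (V A y) (Z y)) x := fun A =>
      (hVU A).mul (hVZ A)
    have hqUZ : ∀ A, MDifferentiableAt (𝓡 n) 𝓘(ℝ)
        (fun y => q A y * (h.inner y (V A y) (U y) * h.inner y (V A y) (Z y))) x := fun A =>
      (hq A).mul (hUZ A)
    rw [Filter.EventuallyEq.mvfderiv_eq h1, mvfderiv_fun_sum _ fun A _ => hqUZ A, hx, hx]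
    simp only [sum_apply, N, ← Finset.sum_add_distrib]
    refine Finset.sum_congr rfl fun A _ => ?_
    rw [mvfderiv_fun_mul (hq A) (hUZ A), mvfderiv_fun_mul (hVU A) (hVZ A)]
    simp only [add_apply, smul_apply, smul_eq_mul]
    rw [hD.2 x u _ _ (hVd A) hU, hD.2 x u _ _ (hVd A) hZ]
    ring
  refine ⟨N, fun v w => ?_, fun u w => ?_, fun u v => ?_, fun u v w => ?_, hN, fun A u => ?_⟩
  · constructor
    · intro u u'
      simp only [N, map_add, add_apply, ← Finset.sum_add_distrib]
      exact Finset.sum_congr rfl fun A _ => by ring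
    · intro c u
      simp only [N, map_smul, smul_apply, smul_eq_mul, Finset.mul_sum]
      exact Finset.sum_congr rfl fun A _ => by ring
  · constructor
    · intro u u'
      simp only [N, map_add, ← Finset.sum_add_distrib]
      exact Finset.sum_congr rfl fun A _ => by ring
    · intro c u
      simp only [N, map_smul, smul_eq_mul, Finset.mul_sum]
      exact Finset.sum_congr rfl fun A _ => by ring
  · constructor
    · intro u u'
      simp only [N, map_add, ← Finset.sum_add_distrib]
      exact Finset.sum_congr rfl fun A _ => by ring
    · intro c u
      simp only [N, map_smul, smul_eq_mul, Finset.mul_sum]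
      exact Finset.sum_congr rfl fun A _ => by ring
  · exact Finset.sum_congr rfl fun A _ => by ring
  -- With both arguments `V A`, the terms in `D (V A)` match `f A` times the derivative of `h(V A, V
  -- A)` and cancel.
  · have h1 := hN u (V A) (V A) (hVd A) (hVd A)
    have h2 : (fun y => diagTensor f Y y (V A y) (V A y)) =ᶠ[𝓝 x]
        fun y => f A y * h.inner y (V A y) (V A y) := by
      filter_upwards [hloc] with y hy
      rw [diagTensor_apply, (hy A).2.1]
      exact Finset.sum_eq_single A (fun B _ hB => by simp [(hy A).2.2 B hB]) (by simp)
    rw [Filter.EventuallyEq.mvfderiv_eq h2, mvfderiv_fun_mul (hf A) (mdifferentiableAt_metric h (hVd A) (hVd A))] at h1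
    simp only [add_apply, smul_apply, smul_eq_mul] at h1
    have hs : ∀ z, diagTensor f Y x (X A x) z = f A x * Y A x z := fun z => by
      simp [diagTensor, H.dual]
    rw [hD.2 x u _ _ (hVd A) (hVd A), hVX, H.diagTensor_frame, hs, H.dual_apply,
      h.symm x (D (V A) x u), H.orthonormal, if_pos rfl] at h1
    linarith

end IsEigenframe
end Geometry

/-! ### Change of connection and of divergence. -/

section Geometry

variable {n : ℕ} {M : Type*} [TopologicalSpace M] [ChartedSpace (EuclideanSpace ℝ (Fin n)) M]

theorem endTrace_add {x : M} (S T : TangentSpace (𝓡 n) x →L[ℝ] TangentSpace (𝓡 n) x) :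
    endTrace (S + T) = endTrace S + endTrace T := by
  simp [endTrace]

theorem endTrace_sub {x : M} (S T : TangentSpace (𝓡 n) x →L[ℝ] TangentSpace (𝓡 n) x) :
    endTrace (S - T) = endTrace S - endTrace T := by
  simp [endTrace]

theorem endTrace_smul {x : M} (c : ℝ) (T : TangentSpace (𝓡 n) x →L[ℝ] TangentSpace (𝓡 n) x) :
    endTrace (c • T) = c * endTrace T := by
  simp [endTrace]

variable [IsManifold (𝓡 n) ∞ M]

theorem torsion_addOneForm_eq_zero {D : AffineConn n M} (hD : D.torsion = 0)
    {C : ∀ x : M, TangentSpace (𝓡 n) x →L[ℝ] TangentSpace (𝓡 n) x →L[ℝ] TangentSpace (𝓡 n) x}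
    (hC : ∀ x u v, C x u v = C x v u) : (D.addOneForm C).torsion = 0 := by
  rw [CovariantDerivative.torsion_eq_zero_iff] at hD ⊢
  intro U Z x hU hZ
  rw [← hD hU hZ]
  change (D Z x + C x (Z x)) (U x) - (D U x + C x (U x)) (Z x) = _
  rw [add_apply, add_apply, hC x (Z x)]
  abel

theorem divergence_addOneForm (D : AffineConn n M)
    (C : ∀ x : M, TangentSpace (𝓡 n) x →L[ℝ] TangentSpace (𝓡 n) x →L[ℝ] TangentSpace (𝓡 n) x)
    (T : EndField n M) (x : M) (w : TangentSpace (𝓡 n) x) :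
    divergence (D.addOneForm C) T x w =
      divergence D T x w + endTrace (C x (T x w)) - endTrace (T x ∘L C x w) := by
  rw [divergence, divergence, ← endTrace_add, ← endTrace_sub]
  congr 1
  change (D _ x + C x (T x (FiberBundle.extend (EuclideanSpace ℝ (Fin n)) w x))) -
    T x ∘L (D _ x + C x (FiberBundle.extend (EuclideanSpace ℝ (Fin n)) w x)) = _
  rw [FiberBundle.extend_apply_self, ContinuousLinearMap.comp_add]
  abel

theorem divergence_const_smul (D : AffineConn n M) {T : EndField n M} (hT : ContMDiff (𝓡 n)
    ((𝓡 n).prod 𝓘(ℝ, EuclideanSpace ℝ (Fin n) →L[ℝ] EuclideanSpace ℝ (Fin n))) ∞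
    (fun x => TotalSpace.mk' (EuclideanSpace ℝ (Fin n) →L[ℝ] EuclideanSpace ℝ (Fin n))
      (E := fun x : M => TangentSpace (𝓡 n) x →L[ℝ] TangentSpace (𝓡 n) x) x (T x)))
    (c : ℝ) (x : M) (w : TangentSpace (𝓡 n) x) :
    divergence D (fun y => c • T y) x w = c * divergence D T x w := by
  rw [divergence, divergence, ← endTrace_smul]
  congr 1
  have hσ : VFieldDiffAt (fun y => T y (FiberBundle.extend (EuclideanSpace ℝ (Fin n)) w y)) x :=
    MDifferentiableAt.clm_bundle_apply ((hT x).mdifferentiableAt (by simp))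
      (FiberBundle.mdifferentiableAt_extend (𝓡 n) (EuclideanSpace ℝ (Fin n)) w)
  have h1 := D.isCovariantDerivativeOnUniv.smul_const c hσ
  rw [smul_sub, ← h1, ContinuousLinearMap.smul_comp]
  rfl

namespace IsEigenframe

variable {h : SmoothMetric n M} {K : EndField n M} {p : Fin n → M → ℝ} {X : Fin n → VField n M}
  {Y : Fin n → CovField n M}

omit [IsManifold (𝓡 n) ∞ M] in
theorem _root_.diagTensor_symm (f : Fin n → M → ℝ) (x : M)
    (v w : TangentSpace (𝓡 n) x) : diagTensor f Y x v w = diagTensor f Y x w v := by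
  rw [diagTensor_apply, diagTensor_apply]
  exact Finset.sum_congr rfl fun A _ => by ring

/-- A nondegenerate diagonal tensor has a Levi-Civita connection, and the divergence of `K` with
respect to it is explicit. -/
theorem exists_leviCivita_diagTensor (H : IsEigenframe h K p X Y) {D : AffineConn n M}
    (hD : IsLeviCivita h.inner D) {f : Fin n → M → ℝ}
    (hf : ∀ A x, MDifferentiableAt (𝓡 n) 𝓘(ℝ) (f A) x) (hf₀ : ∀ A x, f A x ≠ 0) :
    ∃ D' : AffineConn n M, IsLeviCivita (diagTensor f Y) D' ∧
      ∀ x w, divergence D' K x w = divergence D K x w +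
        (∑ A, (f A x)⁻¹ * mvfderiv (𝓡 n) (f A) x (K x w) -
          ∑ A, p A x * ((f A x)⁻¹ * mvfderiv (𝓡 n) (f A) x w)) / 2 := by
  choose N hN₁ hN₂ hN₃ hNs hN hNX using fun x =>
    H.exists_derivative_diagTensor hD (f := f) (x := x) fun A => hf A x
  have hC := fun x => exists_koszul_difference (finrank_tangentSpace x)
    (fun A B => H.dual A B x) (fun A => hf₀ A x) (hN₁ x) (hN₂ x) (hN₃ x)
  choose C hC using hC
  replace hC : ∀ x u v w, diagTensor f Y x (C x u v) w =
    (N x u v w + N x v u w - N x w u v) / 2 := hC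
  have hCs : ∀ x u v, C x u v = C x v u := by
    intro x u v
    have hY : ∀ A, Y A x (C x u v) = Y A x (C x v u) := by
      intro A
      apply mul_left_cancel₀ (hf₀ A x)
      rw [← H.diagTensor_frame, ← H.diagTensor_frame, hC, hC, hNs x (X A x) u v]
      ring
    rw [← dualFrame_expansion (finrank_tangentSpace x) (fun A B => H.dual A B x) (C x u v),
      ← dualFrame_expansion (finrank_tangentSpace x) (fun A B => H.dual A B x) (C x v u)]
    simp only [hY]
  -- On the diagonal the last two Koszul terms cancel by symmetry of `N`, leaving half of `N u (X A)
  -- (X A)`.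
  have hYC : ∀ x A u, Y A x (C x u (X A x)) =
      (f A x)⁻¹ * mvfderiv (𝓡 n) (f A) x u / 2 := by
    intro x A u
    have h1 := H.diagTensor_frame f A x (C x u (X A x))
    rw [hC, hNX, hNs x (X A x) u] at h1
    field_simp [hf₀ A x]
    linarith
  refine ⟨D.addOneForm C, ⟨torsion_addOneForm_eq_zero hD.1 hCs, ?_⟩, fun x w => ?_⟩
  · intro x v U Z hU hZ
    rw [hN x v U Z hU hZ]
    change _ = diagTensor f Y x ((D U x + C x (U x)) v) (Z x) +
      diagTensor f Y x (U x) ((D Z x + C x (Z x)) v)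
    rw [add_apply, add_apply, map_add, map_add, add_apply, diagTensor_symm f x (U x) (C x _ _),
      hC, hC, hNs x v (Z x) (U x), hNs x (Z x) v (U x), hNs x (U x) v (Z x)]
    ring
  -- Since `Y A ∘ K = p A • Y A`, both correction traces involve only the components computed in
  -- `hYC`.
  · rw [divergence_addOneForm, H.endTrace_eq, H.endTrace_eq]
    simp only [ContinuousLinearMap.comp_apply, H.dual_comp, hYC]
    rw [sub_div, Finset.sum_div, Finset.sum_div, add_sub_assoc]
    congr 2
    exact Finset.sum_congr rfl fun A _ => by ring

end IsEigenframe
end Geometry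

/-! ### Joint smoothness in time and space. -/

section Geometry

variable {n : ℕ} {M : Type*} [TopologicalSpace M] [ChartedSpace (EuclideanSpace ℝ (Fin n)) M]
  [IsManifold (𝓡 n) ∞ M]

theorem contMDiffAt_metric (h : SmoothMetric n M) {U Z : VField n M} {x : M}
    (hU : VFieldSmoothAt U x) (hZ : VFieldSmoothAt Z x) :
    ContMDiffAt (𝓡 n) 𝓘(ℝ) ∞ (fun y => h.inner y (U y) (Z y)) x := by
  have : ContMDiffAt (𝓡 n) ((𝓡 n).prod 𝓘(ℝ)) ∞
      (fun m ↦ TotalSpace.mk' ℝ (E := Bundle.Trivial M ℝ) m (h.inner m (U m) (Z m))) x := by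
    apply ContMDiffAt.clm_bundle_apply₂ (F₁ := EuclideanSpace ℝ (Fin n))
      (F₂ := EuclideanSpace ℝ (Fin n))
    · exact h.contMDiff.contMDiffAt
    · exact hU
    · exact hZ
  exact (contMDiffAt_totalSpace.mp this).2

/-- The one-form `h(U, ·)` read in the trivialization of the tangent bundle at `x₀`. -/
theorem contMDiffAt_flat_symmL (h : SmoothMetric n M) {U : VField n M} {x₀ : M}
    (hU : VFieldSmoothAt U x₀) :
    ∃ θ : M → EuclideanSpace ℝ (Fin n) →L[ℝ] ℝ,
      ContMDiffAt (𝓡 n) 𝓘(ℝ, EuclideanSpace ℝ (Fin n) →L[ℝ] ℝ) ∞ θ x₀ ∧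
      ∀ᶠ y in 𝓝 x₀, ∀ v, θ y v = h.inner y (U y)
        ((trivializationAt (EuclideanSpace ℝ (Fin n)) (TangentSpace (𝓡 n)) x₀).symm y v) := by
  have : ContMDiffAt (𝓡 n) ((𝓡 n).prod 𝓘(ℝ, EuclideanSpace ℝ (Fin n) →L[ℝ] ℝ)) ∞
      (fun m ↦ TotalSpace.mk' (EuclideanSpace ℝ (Fin n) →L[ℝ] ℝ)
        (E := fun m : M => TangentSpace (𝓡 n) m →L[ℝ] Bundle.Trivial M ℝ m)
        m (h.inner m (U m))) x₀ := by
    apply ContMDiffAt.clm_bundle_apply (F₁ := EuclideanSpace ℝ (Fin n))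
    · exact h.contMDiff.contMDiffAt
    · exact hU
  refine ⟨_, ((contMDiffAt_hom_bundle _).mp this).2, ?_⟩
  filter_upwards [(trivializationAt (EuclideanSpace ℝ (Fin n)) (TangentSpace (𝓡 n))
    x₀).open_baseSet.mem_nhds (mem_baseSet_trivializationAt _ _ x₀)] with y hy v
  rw [ContinuousLinearMap.inCoordinates_eq hy (by simp)]
  simp

/-- Only the coefficients depend on `t`. In a trivialization the tensors `Y^A ⊗ Y^A` are normalized
squares of the smooth one-forms `h(V A, ·)`, so sign jumps of `Y` are invisible. -/
theorem IsEigenframe.smoothFamily_diagTensor {h : SmoothMetric n M} {K : EndField n M}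
    {p : Fin n → M → ℝ} {X : Fin n → VField n M} {Y : Fin n → CovField n M}
    (H : IsEigenframe h K p X Y) {f : ℝ → Fin n → M → ℝ}
    (hf : ∀ A, ContMDiffOn (𝓘(ℝ).prod (𝓡 n)) 𝓘(ℝ) ∞ (fun q : ℝ × M => f q.1 A q.2)
      (Ioi 0 ×ˢ univ)) :
    SmoothFamily fun t => diagTensor (f t) Y := by
  rintro ⟨t₀, x₀⟩ hq
  obtain ⟨V, hV, -, hloc⟩ := H.exists_local_frame x₀
  choose θ hθ hθe using fun A => contMDiffAt_flat_symmL h (hV A)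
  have hsnd : ContMDiffWithinAt (𝓘(ℝ).prod (𝓡 n)) (𝓡 n) ∞ (fun q : ℝ × M => q.2)
    (Ioi 0 ×ˢ univ) (t₀, x₀) := contMDiffWithinAt_snd
  rw [contMDiffWithinAt_hom_bundle]
  refine ⟨hsnd, ?_⟩
  have hs : ∀ A, ContMDiffAt (𝓡 n) 𝓘(ℝ) ∞ (fun y => (h.inner y (V A y) (V A y))⁻¹) x₀ := fun A =>
    (contMDiffAt_metric h (hV A) (hV A)).inv₀ (hloc.self_of_nhds A).1
  have hsm : ContMDiffWithinAt (𝓘(ℝ).prod (𝓡 n))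
      𝓘(ℝ, EuclideanSpace ℝ (Fin n) →L[ℝ] EuclideanSpace ℝ (Fin n) →L[ℝ] ℝ) ∞
      (fun q : ℝ × M => ∑ A, (f q.1 A q.2 * (h.inner q.2 (V A q.2) (V A q.2))⁻¹) •
        (θ A q.2).smulRight (θ A q.2)) (Ioi 0 ×ˢ univ) (t₀, x₀) := by
    refine contMDiffWithinAt_finsetSum fun A _ => ?_
    have hθq := (hθ A).comp_contMDiffWithinAt (t₀, x₀) hsnd
    have h1 := (hf A _ hq).mul ((hs A).comp_contMDiffWithinAt (t₀, x₀) hsnd)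
    have h2 := ((contDiff_id.smulRight contDiff_id :
      ContDiff ℝ ∞ fun α : EuclideanSpace ℝ (Fin n) →L[ℝ] ℝ => α.smulRight α).contDiffAt.contMDiffAt
        ).comp_contMDiffWithinAt (t₀, x₀) hθq
    exact h1.smul h2
  refine hsm.congr_of_eventuallyEq_of_mem ?_ hq
  have hev : ∀ᶠ y in 𝓝 x₀, ∀ t, ContinuousLinearMap.inCoordinates (EuclideanSpace ℝ (Fin n))
      (TangentSpace (𝓡 n)) (EuclideanSpace ℝ (Fin n) →L[ℝ] ℝ)
      (fun x : M => TangentSpace (𝓡 n) x →L[ℝ] ℝ) x₀ y x₀ y (diagTensor (f t) Y y) =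
      ∑ A, (f t A y * (h.inner y (V A y) (V A y))⁻¹) • (θ A y).smulRight (θ A y) := by
    filter_upwards [hloc, eventually_all.mpr hθe, (trivializationAt (EuclideanSpace ℝ (Fin n))
      (TangentSpace (𝓡 n)) x₀).open_baseSet.mem_nhds (mem_baseSet_trivializationAt _ _ x₀)]
      with y hy hθy hyb t
    ext v w
    refine (inCoordinates_apply_eq₂ (E₃ := Bundle.Trivial M ℝ) hyb hyb (mem_univ _)).trans ?_
    refine Eq.trans (b := diagTensor (f t) Y y
      ((trivializationAt (EuclideanSpace ℝ (Fin n)) (TangentSpace (𝓡 n)) x₀).symm y v)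
      ((trivializationAt (EuclideanSpace ℝ (Fin n)) (TangentSpace (𝓡 n)) x₀).symm y w)) ?_ ?_
    · simp
    rw [diagTensor_apply, sum_apply, sum_apply]
    refine Finset.sum_congr rfl fun A _ => ?_
    simp only [smul_apply, ContinuousLinearMap.smulRight_apply, smul_eq_mul, hθy]
    have h1 := (hy A).1
    rw [(hy A).2.1 (V A y)] at h1 ⊢
    have h2 := left_ne_zero_of_mul h1
    rw [(hy A).2.1, (hy A).2.1]
    field_simp
  have hc : ContinuousWithinAt (fun q : ℝ × M => q.2) (Ioi 0 ×ˢ univ) (t₀, x₀) :=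
    hsnd.continuousWithinAt
  filter_upwards [hc.eventually hev] with q hq using hq q.1

end Geometry

/-! ### The mixed second fundamental form and its traces. -/

section Geometry

variable {n : ℕ} {M : Type*} [TopologicalSpace M] [ChartedSpace (EuclideanSpace ℝ (Fin n)) M]

theorem mvfderiv_comp_hasDerivAt {p : M → ℝ} {x : M} (hp : MDifferentiableAt (𝓡 n) 𝓘(ℝ) p x)
    {F : ℝ → ℝ} {F' : ℝ} (hF : HasDerivAt F F' (p x)) (u : TangentSpace (𝓡 n) x) :
    mvfderiv (𝓡 n) (fun y => F (p y)) x u = F' * mvfderiv (𝓡 n) p x u := by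
  change @Eq ℝ (mfderiv (𝓡 n) 𝓘(ℝ) (F ∘ p) x u)
    (@HMul.hMul ℝ ℝ ℝ _ F' (mfderiv (𝓡 n) 𝓘(ℝ) p x u))
  rw [mfderiv_comp_apply x hF.differentiableAt.mdifferentiableAt hp, mfderiv_eq_fderiv,
    hF.hasFDerivAt.fderiv]
  exact mul_comm _ _

theorem hasDerivAt_tangentSpace_of_eventuallyEq_smul {x : M} (v : TangentSpace (𝓡 n) x)
    {f : ℝ → TangentSpace (𝓡 n) x} {c : ℝ → ℝ} {c' t : ℝ} (hc : HasDerivAt c c' t)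
    (hf : f =ᶠ[𝓝 t] fun s => c s • v) : HasDerivAt f (c' • v) t := by
  -- The tangent space is unfolded to the model space, whose norm the product rule uses.
  have key : ∀ (v : EuclideanSpace ℝ (Fin n)) (f : ℝ → EuclideanSpace ℝ (Fin n)),
      (f =ᶠ[𝓝 t] fun s => c s • v) → HasDerivAt f (c' • v) t := fun v f hf =>
    (hc.smul_const v).congr_of_eventuallyEq hf
  exact key v f hf

theorem diagTensor_neg (f : Fin n → M → ℝ) (Y : Fin n → CovField n M) :
    -diagTensor f Y = diagTensor (fun A x => -f A x) Y := by
  funext x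
  ext v w
  simp [diagTensor]

variable [IsManifold (𝓡 n) ∞ M]
variable {h : SmoothMetric n M} {K : EndField n M} {p : Fin n → M → ℝ} {X : Fin n → VField n M}
  {Y : Fin n → CovField n M}

namespace IsEigenframe

theorem raiseIndex_diagTensor (H : IsEigenframe h K p X Y) {f q : Fin n → M → ℝ} {x : M}
    (hf : ∀ A, f A x ≠ 0) (v : TangentSpace (𝓡 n) x) :
    raiseIndex (diagTensor f Y x) (diagTensor q Y x) v =
      ∑ A, ((f A x)⁻¹ * q A x * Y A x v) • X A x := by
  change (∑ A, f A x • (Y A x).smulRight (Y A x)).inverse (diagTensor q Y x v) = _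
  rw [inverse_sum_dualFrame_apply (finrank_tangentSpace x) (fun A B => H.dual A B x) hf]
  refine Finset.sum_congr rfl fun A _ => ?_
  rw [H.diagTensor_frame, mul_assoc]

/-- On each eigenline the factor is `t^(-2p) · (-p t^(2p-1)) = -p/t`. -/
theorem mixedK_eq (H : IsEigenframe h K p X Y) {t : ℝ} (ht : 0 < t) (x : M) :
    mixedK (fun t => diagTensor (fun A x => t ^ (2 * p A x)) Y)
      (fun t => -diagTensor (fun A x => p A x * t ^ (2 * p A x - 1)) Y) t x = (-t⁻¹) • K x := by
  ext1 v
  rw [mixedK, diagTensor_neg, H.raiseIndex_diagTensor fun A => (Real.rpow_pos_of_pos ht _).ne']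
  conv_rhs => rw [smul_apply, ← dualFrame_expansion (finrank_tangentSpace x)
    (fun A B => H.dual A B x) (K x v), Finset.smul_sum]
  refine Finset.sum_congr rfl fun A _ => ?_
  rw [H.dual_comp, smul_smul, Real.rpow_sub_one ht.ne']
  have := (Real.rpow_pos_of_pos ht (2 * p A x)).ne'
  congr 1
  field_simp

theorem raiseIndex_smul_self (H : IsEigenframe h K p X Y) {f : Fin n → M → ℝ} {x : M}
    (hf : ∀ A, f A x ≠ 0) (c : ℝ) :
    raiseIndex (diagTensor f Y x) (c • diagTensor f Y x) =
      c • ContinuousLinearMap.id ℝ (TangentSpace (𝓡 n) x) := by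
  ext1 v
  have h1 : raiseIndex (diagTensor f Y x) (c • diagTensor f Y x) v =
      c • raiseIndex (diagTensor f Y x) (diagTensor f Y x) v := by
    simp [raiseIndex]
  rw [h1, H.raiseIndex_diagTensor hf, smul_apply, ContinuousLinearMap.id_apply]
  conv_rhs => rw [← dualFrame_expansion (finrank_tangentSpace x) (fun A B => H.dual A B x) v]
  congr 1
  refine Finset.sum_congr rfl fun A _ => ?_
  rw [inv_mul_cancel₀ (hf A), one_mul]

theorem endTrace_K (H : IsEigenframe h K p X Y) (x : M) : endTrace (K x) = ∑ A, p A x := by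
  rw [H.endTrace_eq]
  simp [H.dual_comp, H.dual]

theorem endTrace_K_comp_K (H : IsEigenframe h K p X Y) (x : M) :
    endTrace (K x ∘L K x) = ∑ A, p A x ^ 2 := by
  rw [H.endTrace_eq]
  simp [H.dual_comp, H.dual, sq]

theorem contMDiffOn_rpow (H : IsEigenframe h K p X Y) (A : Fin n) (c : ℝ) :
    ContMDiffOn (𝓘(ℝ).prod (𝓡 n)) 𝓘(ℝ) ∞ (fun q : ℝ × M => q.1 ^ (2 * p A q.2 - c))
      (Ioi 0 ×ˢ univ) := by
  rintro ⟨t, x⟩ hq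
  have ht : (0 : ℝ) < t := hq.1
  have h1 : ContMDiffAt (𝓘(ℝ).prod (𝓡 n)) 𝓘(ℝ) ∞ (fun q : ℝ × M => 2 * p A q.2 - c) (t, x) :=
    ((contMDiffAt_const (c := (2 : ℝ))).mul
      ((H.contMDiff_eigenvalue A).contMDiffAt.comp (t, x) contMDiffAt_snd)).sub contMDiffAt_const
  have h2 : ContMDiffAt (𝓘(ℝ).prod (𝓡 n)) 𝓘(ℝ, ℝ × ℝ) ∞
      (fun q : ℝ × M => (q.1, 2 * p A q.2 - c)) (t, x) :=
    ContMDiffAt.prodMk_space contMDiffAt_fst h1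
  exact ((Real.contDiffAt_rpow_of_ne (t, 2 * p A x - c) ht.ne').contMDiffAt.comp (t, x)
    h2).contMDiffWithinAt

end IsEigenframe

end Geometry

/-! ### Verification of the velocity dominated equations. -/

theorem mainTheorem10 {n : ℕ} {M : Type*} [TopologicalSpace M] [T2Space M]
    [SecondCountableTopology M] [ChartedSpace (EuclideanSpace ℝ (Fin n)) M]
    [IsManifold (𝓡 n) ∞ M]
    (h : SmoothMetric n M) (K : EndField n M) (Φa Φb : M → ℝ)
    (hdata : IsQuiescentData h K Φa Φb)
    (p : Fin n → M → ℝ) (hp : AreOrderedEigenvalues K p)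
    (X : Fin n → VField n M) (hX : ∀ x, IsUnitEigenframeAt h.inner K p X x)
    (Y : Fin n → CovField n M) (hY : ∀ A B x, Y A x (X B x) = if A = B then 1 else 0) :
    IsVelocityDominatedSolution
      (fun t => diagTensor (fun A x => t ^ (2 * p A x)) Y)
      (fun t => -diagTensor (fun A x => p A x * t ^ (2 * p A x - 1)) Y)
      (fun t x => Φa x * Real.log t + Φb x) := by
  have H : IsEigenframe h K p X Y := ⟨hdata.smooth_K, hdata.symm, hp, hX, hY⟩
  have hφ : ∀ t > 0, ∀ x, HasDerivAt (fun s => Φa x * Real.log s + Φb x) (Φa x * t⁻¹) t :=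
    fun t ht x => ((Real.hasDerivAt_log (ne_of_gt ht)).const_mul _).add_const _
  have hφd : ∀ t > 0, ∀ x, deriv (fun s => Φa x * Real.log s + Φb x) t = Φa x * t⁻¹ :=
    fun t ht x => (hφ t ht x).deriv
  have htr : ∀ x, ∑ A, p A x = 1 := fun x => by rw [← H.endTrace_K, hdata.trace_eq]
  have hsq : ∀ x, ∑ A, p A x ^ 2 + Φa x ^ 2 = 1 := fun x => by
    rw [← H.endTrace_K_comp_K, hdata.hamiltonian]
  have hn1 : (n : ℝ) - 1 ≠ 0 := by
    have : (3 : ℝ) ≤ n := by exact_mod_cast hdata.three_le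
    linarith
  have hpos : ∀ t > (0 : ℝ), ∀ A x, 0 < t ^ (2 * p A x) := fun t ht A x =>
    Real.rpow_pos_of_pos ht _
  have hmK : ∀ t > 0, ∀ x, endTrace (mixedK (fun t => diagTensor (fun A x => t ^ (2 * p A x)) Y)
      (fun t => -diagTensor (fun A x => p A x * t ^ (2 * p A x - 1)) Y) t x) = -t⁻¹ := by
    intro t ht x
    rw [H.mixedK_eq ht, endTrace_smul, hdata.trace_eq, mul_one]
  refine ⟨?_, ?_, ?_, ?_, ?_, ?_, ?_, ?_, ?_, ?_, ?_⟩
  · exact H.smoothFamily_diagTensor fun A => by simpa using H.contMDiffOn_rpow A 0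
  · simp only [diagTensor_neg]
    refine H.smoothFamily_diagTensor (f := fun t A x => -(p A x * t ^ (2 * p A x - 1))) fun A => ?_
    exact (((H.contMDiff_eigenvalue A).comp contMDiff_snd).contMDiffOn.mul
      (H.contMDiffOn_rpow A 1)).neg
  · rintro ⟨t, x⟩ hq
    have ht : (0 : ℝ) < t := hq.1
    have h1 : ContMDiffAt (𝓘(ℝ).prod (𝓡 n)) 𝓘(ℝ) ∞ (fun q : ℝ × M => Real.log q.1) (t, x) :=
      (Real.contDiffAt_log.mpr ht.ne').contMDiffAt.comp (t, x) contMDiffAt_fst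
    exact ((((hdata.smooth_Φa.comp contMDiff_snd).contMDiffAt).mul h1).add
      ((hdata.smooth_Φb.comp contMDiff_snd).contMDiffAt)).contMDiffWithinAt
  · exact fun t _ x v w => diagTensor_symm _ x v w
  · intro t ht x v hv
    rw [diagTensor_apply]
    have hex : ∃ A, Y A x v ≠ 0 := by
      by_contra! hc
      apply hv
      rw [← dualFrame_expansion (finrank_tangentSpace x) (fun A B => hY A B x) v]
      simp [hc]
    obtain ⟨A, hA⟩ := hex
    exact Finset.sum_pos' (fun B _ => mul_nonneg (hpos t ht B x).le (mul_self_nonneg _))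
      ⟨A, Finset.mem_univ A, mul_pos (hpos t ht A x) (mul_self_pos.mpr hA)⟩
  · intro t _ x v w
    simp only [diagTensor_neg]
    exact diagTensor_symm _ x v w
  · intro t ht x
    rw [hmK t ht, H.mixedK_eq ht, vdRho, hφd t ht, ContinuousLinearMap.smul_comp,
      ContinuousLinearMap.comp_smul, endTrace_smul, endTrace_smul]
    -- The claim is `t⁻² (1 - tr K²) = t⁻² Φa²`.
    linear_combination (-(t⁻¹) ^ 2) * (hdata.hamiltonian x)
  · intro t ht
    obtain ⟨D, hD, hdiv⟩ := hdata.momentum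
    have hpd : ∀ A x, MDifferentiableAt (𝓡 n) 𝓘(ℝ) (p A) x := fun A x =>
      (H.contMDiff_eigenvalue A x).mdifferentiableAt (by simp)
    have had : ∀ x, MDifferentiableAt (𝓡 n) 𝓘(ℝ) Φa x := fun x =>
      (hdata.smooth_Φa x).mdifferentiableAt (by simp)
    have hbd : ∀ x, MDifferentiableAt (𝓡 n) 𝓘(ℝ) Φb x := fun x =>
      (hdata.smooth_Φb x).mdifferentiableAt (by simp)
    -- At fixed `t` the weights vary in space through the exponent; this produces the `ln t` that
    -- matches the one in `φ`.
    have hF : ∀ r : ℝ, HasDerivAt (fun r => t ^ (2 * r)) (2 * Real.log t * t ^ (2 * r)) r := by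
      intro r
      have := ((hasDerivAt_id r).const_mul 2).const_rpow ht
      simpa [mul_comm, mul_assoc, mul_left_comm] using this
    have hfd : ∀ A x, MDifferentiableAt (𝓡 n) 𝓘(ℝ) (fun y => t ^ (2 * p A y)) x := fun A x =>
      (hF (p A x)).differentiableAt.mdifferentiableAt.comp x (hpd A x)
    obtain ⟨D', hD', hdiv'⟩ := H.exists_leviCivita_diagTensor hD hfd
      fun A x => (hpos t ht A x).ne'
    refine ⟨D', hD', fun x w => ?_⟩
    have hmix : mixedK (fun t => diagTensor (fun A x => t ^ (2 * p A x)) Y)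
        (fun t => -diagTensor (fun A x => p A x * t ^ (2 * p A x - 1)) Y) t =
        fun x => (-t⁻¹) • K x := funext fun x => H.mixedK_eq ht x
    have hlog : ∀ A u, (t ^ (2 * p A x))⁻¹ * mvfderiv (𝓡 n) (fun y => t ^ (2 * p A y)) x u =
        2 * Real.log t * mvfderiv (𝓡 n) (p A) x u := by
      intro A u
      rw [mvfderiv_comp_hasDerivAt (hpd A x) (hF (p A x))]
      have := (hpos t ht A x).ne'
      field_simp
    -- The derivative of `tr K = 1`.
    have hdtr : ∀ u, ∑ A, mvfderiv (𝓡 n) (p A) x u = 0 := by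
      intro u
      have h1 := mvfderiv_fun_sum Finset.univ (f := p) (x := x) fun A _ => hpd A x
      simp only [htr, mvfderiv_const] at h1
      simpa using (congrArg (fun L => L u) h1).symm
    -- Half the derivative of `tr K² + Φa² = 1`.
    have hdsq : ∑ A, p A x * mvfderiv (𝓡 n) (p A) x w = -(Φa x * mvfderiv (𝓡 n) Φa x w) := by
      have h1 : Φa x * mvfderiv (𝓡 n) Φa x w + ∑ A, p A x * mvfderiv (𝓡 n) (p A) x w = 0 := by
        have hpp : ∀ A, MDifferentiableAt (𝓡 n) 𝓘(ℝ) (fun y => p A y * p A y) x := fun A =>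
          (hpd A x).mul (hpd A x)
        have haa : MDifferentiableAt (𝓡 n) 𝓘(ℝ) (fun y => Φa y * Φa y) x := (had x).mul (had x)
        have h2 : (fun y => ∑ A, p A y * p A y + Φa y * Φa y) = fun _ : M => (1 : ℝ) := by
          funext y
          rw [← hsq y]
          simp [sq]
        have h3 := congrArg (fun F => mvfderiv (𝓡 n) F x w) h2
        simp only [mvfderiv_const, mvfderiv_fun_add (mdifferentiableAt_fun_sum _ fun A _ => hpp A)
          haa, mvfderiv_fun_sum _ fun A _ => hpp A, mvfderiv_fun_mul (had x) (had x),
          fun A => mvfderiv_fun_mul (hpd A x) (hpd A x), add_apply, sum_apply, smul_apply,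
          zero_apply, smul_eq_mul, Finset.sum_add_distrib] at h3
        linarith
      linarith
    have hdφ : mvfderiv (𝓡 n) (fun y => Φa y * Real.log t + Φb y) x w =
        mvfderiv (𝓡 n) Φa x w * Real.log t + mvfderiv (𝓡 n) Φb x w := by
      have hal : MDifferentiableAt (𝓡 n) 𝓘(ℝ) (fun y => Φa y * Real.log t) x :=
        (had x).mul mdifferentiableAt_const
      rw [mvfderiv_fun_add hal (hbd x), mvfderiv_fun_mul (had x) mdifferentiableAt_const,
        mvfderiv_const]
      simp [mul_comm]
    have hc : (fun y => endTrace (mixedK (fun t => diagTensor (fun A x => t ^ (2 * p A x)) Y)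
        (fun t => -diagTensor (fun A x => p A x * t ^ (2 * p A x - 1)) Y) t y)) =
        fun _ : M => -t⁻¹ := funext fun y => hmK t ht y
    rw [hc, hmix, divergence_const_smul D' hdata.smooth_K, hdiv', hdiv]
    beta_reduce
    rw [mvfderiv_const, vdJ]
    simp only [hlog, ← Finset.mul_sum, hdtr, hφd t ht, add_apply, zero_apply, neg_apply, smul_apply,
      smul_eq_mul, hdφ, mul_left_comm (p _ x), hdsq]
    ring
  · intro t ht x v w
    have h1 : ∀ A, HasDerivAt (fun s : ℝ => s ^ (2 * p A x))
        (2 * (p A x * t ^ (2 * p A x - 1))) t := fun A => by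
      have := Real.hasDerivAt_rpow_const (p := 2 * p A x) (Or.inl (ne_of_gt ht))
      rwa [mul_assoc] at this
    have h2 := HasDerivAt.fun_sum fun A (_ : A ∈ Finset.univ) =>
      (h1 A).mul_const (Y A x v * Y A x w)
    simp only [diagTensor_neg, diagTensor_apply]
    refine h2.congr_deriv ?_
    rw [Finset.mul_sum]
    exact Finset.sum_congr rfl fun A _ => by ring
  · intro t ht x v
    have h1 : HasDerivAt (fun s : ℝ => -s⁻¹) (t ^ 2)⁻¹ t := by
      have := (hasDerivAt_inv (ne_of_gt ht)).neg
      rw [neg_neg] at this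
      exact this
    have h2 : (fun s => mixedK (fun t => diagTensor (fun A x => t ^ (2 * p A x)) Y)
        (fun t => -diagTensor (fun A x => p A x * t ^ (2 * p A x - 1)) Y) s x v) =ᶠ[𝓝 t]
        fun s => (-s⁻¹) • K x v := by
      filter_upwards [Ioi_mem_nhds ht] with s hs
      rw [H.mixedK_eq hs, smul_apply]
    have h3 := hasDerivAt_tangentSpace_of_eventuallyEq_smul (K x v) h1 h2
    convert h3 using 1
    have hid : endTrace (ContinuousLinearMap.id ℝ (TangentSpace (𝓡 n) x)) = n := by
      rw [endTrace, ContinuousLinearMap.coe_id, LinearMap.trace_id, finrank_tangentSpace]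
    rw [hmK t ht, H.mixedK_eq ht, vdS, H.raiseIndex_smul_self fun A => (hpos t ht A x).ne',
      endTrace_smul, hid, vdRho, smul_apply, smul_apply, ContinuousLinearMap.id_apply, smul_smul,
      ← sub_smul, sub_sub, ← add_smul]
    -- The matter terms cancel because `1 - n/(n-1) + 1/(n-1) = 0`; what remains is `∂_t (-t⁻¹) K =
    -- (tr k) (-t⁻¹) K`.
    have h4 : 1 / 2 * (Φa x * t⁻¹) ^ 2 - 1 / 2 * (Φa x * t⁻¹) ^ 2 * n / ((n : ℝ) - 1) +
        1 / 2 * (Φa x * t⁻¹) ^ 2 / ((n : ℝ) - 1) = 0 := by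
      field_simp
      ring
    have h5 : -t⁻¹ * -t⁻¹ = (t ^ 2)⁻¹ := by
      rw [neg_mul_neg, ← mul_inv, sq]
    rw [hφd t ht, h4, zero_smul, sub_zero, h5]
  · intro t ht x
    rw [hmK t ht]
    have h1 : HasDerivAt (fun s : ℝ => Φa x * s⁻¹) (Φa x * -(t ^ 2)⁻¹) t :=
      (hasDerivAt_inv (ne_of_gt ht)).const_mul _
    have h2 : (fun s => deriv (fun r => Φa x * Real.log r + Φb x) s) =ᶠ[𝓝 t]
        fun s => Φa x * s⁻¹ := by
      filter_upwards [Ioi_mem_nhds ht] with s hs using hφd s hs x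
    refine (h1.congr_of_eventuallyEq h2).congr_deriv ?_
    rw [hφd t ht]
    ring
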